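/- Let $n\in\mathbb N_0$. Let $A_a,B_a$ ($a=1,\dots,n$) be $2n$ decoupled harmonic oscillators, $[A_a,A_b^\dagger]=[B_a,B_b^\dagger]=\delta_{ab}$, acting in the standard way on the Fock space $\mathcal F_n$, i.e. the complex inner product space with orthonormal basis the occupation-number vectors $|\mu,\nu\rangle$, $\mu,\nu\in\mathbb N_0^n$ (finite linear combinations), and let $|0\rangle$ be the vacuum. Let $$J_z=\tfrac12\sum_a(A_a^\dagger A_a-B_a^\dagger B_a),\qquad J_+=\sum_aA_a^\dagger B_a,\qquad J_-=\sum_aB_a^\dagger A_a$$ be the total angular momentum operators. For $j_1,\dots,j_n\in\frac12\mathbb N_0$ identify the tensor product $F_{j_1}\otimes\dots\otimes F_{j_n}$ of irreducible $\mathrm{SU}(2)$ representations with the span of the $|\mu,\nu\rangle$ such that $\mu_a+\nu_a=2j_a$ for all $a$, let $\mathrm{Inv}_{\mathrm{SU}(2)}(F_{j_1}\otimes\dots\otimes F_{j_n})$ be its subspace of vectors annihilated by $J_z,J_\pm$, and for $J\in\mathbb N_0$ let $$\mathcal H_n^J=\bigoplus_{\sum_aj_a=J}\mathrm{Inv}_{\mathrm{SU}(2)}(F_{j_1}\otimes\dots\otimes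 F_{j_n}),\qquad \mathcal H_n=\bigoplus_{J\ge0}\mathcal H_n^J$$ (algebraic direct sums): the intertwiners of total area $J$, and all intertwiners. Let $$E_{ab}=A_a^\dagger A_b+B_a^\dagger B_b+\delta_{ab},\qquad F_{ab}=B_aA_b-A_aB_b,\qquad \widetilde F_{ab}=B_a^\dagger A_b^\dagger-A_a^\dagger B_b^\dagger .$$ Let $\mathrm{SO}^*(2n)$ be the group of all $g\in\mathrm{SU}(n,n)$ with $g^{T}\begin{pmatrix}0&1\\1&0\end{pmatrix}g=\begin{pmatrix}0&1\\1&0\end{pmatrix}$, let $\mathfrak g=\mathfrak{so}^*(2n)=\left\{\begin{pmatrix}X&Y\\-\overline Y&\overline X\end{pmatrix}: X^*=-X,\ Y^T=-Y\right\}$ be its Lie algebra and $K=\{\mathrm{diag}(U,\overline U):U\in\mathrm U(n)\}$ its maximal compact subgroup. A $(\mathfrak g,K)$-module is a complex vector space with actions of $\mathfrak g$ and $K$ such that $kXv=(\mathrm{Ad}(k)X)kv$, each $Kv$ spans a finite-dimensional space on which $K$ acts continuously, and $\frac{d}{dt}\big|_{t=0}e^{tY}v=Yv$ for $Y$ in the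 Lie algebra of $K$. It is unitary for a given inner product if $\mathfrak g$ acts by skew-adjoint and $K$ by unitary operators. Then the following hold. 1. Each $E_{ab},F_{ab},\widetilde F_{ab}$ commutes with $J_z,J_+,J_-$, and these operators satisfy the relations of $\mathfrak{so}^*(2n)_{\mathbb C}$: $F_{ba}=-F_{ab}$, $\widetilde F_{ba}=-\widetilde F_{ab}$ and $$\begin{aligned} [E_{ab},E_{cd}]&=\delta_{cb}E_{ad}-\delta_{ad}E_{cb},\\ [E_{ab},\widetilde F_{cd}]&=\delta_{bc}\widetilde F_{ad}-\delta_{bd}\widetilde F_{ac},\\ [E_{ab},F_{cd}]&=\delta_{ad}F_{bc}-\delta_{ac}F_{bd},\\ [F_{ab},\widetilde F_{cd}]&=\delta_{db}E_{ca}+\delta_{ca}E_{db}-\delta_{cb}E_{da}-\delta_{da}E_{cb},\\ [F_{ab},F_{cd}]&=[\widetilde F_{ab},\widetilde F_{cd}]=0 . \end{aligned}$$ Moreover $\langle E_{ab}v,w\rangle=\langle v,E_{ba}w\rangle$ and $\langle F_{ab}v,w\rangle=\langle v,\widetilde F_{ab}w\rangle$ for all $v,w\in\mathcal F_n$. 2.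 $\mathcal H_n$ is the space of all vectors of $\mathcal F_n$ annihilated by $J_z,J_\pm$. It is stable under all $E_{ab},F_{ab},\widetilde F_{ab}$, and its only subspaces stable under all of them are $0$ and $\mathcal H_n$. There is an irreducible $(\mathfrak g,K)$-module structure on $\mathcal H_n$, unitary for the Fock inner product, in which $\begin{pmatrix}X&Y\\-\overline Y&\overline X\end{pmatrix}\in\mathfrak g$ acts as $\sum_{a,b}\left(X_{ab}E_{ab}+\tfrac12Y_{ab}\widetilde F_{ab}-\tfrac12\overline{Y_{ab}}F_{ab}\right)$, and in which $K\cong\mathrm U(n)$ preserves each $\mathcal H_n^J$. 3. Let $n\ge2$ and $J\in\mathbb N_0$. Then $\mathcal H_n^J$ is stable under all $E_{ab}$, its only subspaces stable under all $E_{ab}$ are $0$ and $\mathcal H_n^J$, and $$|\psi_J\rangle=\frac1{\sqrt{J!\,(J+1)!}}\,(\widetilde F_{12})^J|0\rangle$$ is a unit vector of $\mathcal H_n^J$ which is a highest weight vector of weight $[J+1,J+1,1,\dots,1]$: $E_{aa}\psi_J=(J+1)\psi_J$ for $a\le2$, $E_{aa}\psi_J=\psi_J$ for $a>2$, and $E_{ab}\psi_J=0$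 for $a<b$. Up to a phase it is the only highest weight vector of norm $1$ in $\mathcal H_n^J$: if $w\in\mathcal H_n^J$ has norm $1$, is an eigenvector of every $E_{aa}$ and satisfies $E_{ab}w=0$ for all $a<b$, then $w=e^{i\theta}\psi_J$ for some $\theta\in\mathbb R$. -/

import Mathlib

open Matrix
open scoped ComplexConjugate

attribute [local instance] LieRing.ofAssociativeRing

noncomputable section

namespace SOStar

/-! ### The Fock space of `2n` harmonic oscillators -/

/-- Occupation numbers of the `2n` oscillators: `μ (Sum.inl a)` is the number of quanta of the
oscillator `A_a`, and `μ (Sum.inr a)` is that of `B_a`. -/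
abbrev Occ (n : ℕ) : Type := (Fin n ⊕ Fin n) →₀ ℕ

/-- The (algebraic) Fock space: the complex vector space spanned by the occupation number
vectors `|μ⟩`. -/
abbrev Fock (n : ℕ) : Type := Occ n →₀ ℂ

/-- The basis vector `|μ⟩`. -/
def ket {n : ℕ} (μ : Occ n) : Fock n := Finsupp.single μ 1

/-- The vacuum `|0⟩`. -/
def vacuum (n : ℕ) : Fock n := ket 0

/-- The inner product `⟨v|w⟩ = ∑_μ conj (v_μ) w_μ`, for which the vectors `|μ⟩` are
orthonormal. It is conjugate linear in the first argument. -/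
def fockInner (n : ℕ) : Fock n →ₗ⋆[ℂ] Fock n →ₗ[ℂ] ℂ :=
  LinearMap.mk₂'ₛₗ (starRingEnd ℂ) (RingHom.id ℂ)
    (fun v w => v.sum fun μ c => conj c * w μ)
    (fun v₁ v₂ w => by
      classical
      exact Finsupp.sum_add_index' (by simp) (by intros; simp [add_mul]))
    (fun c v w => by
      rw [Finsupp.sum_smul_index (by simp), Finsupp.smul_sum]
      exact Finsupp.sum_congr (by intros; simp [mul_assoc]))
    (fun v w₁ w₂ => by simp [mul_add, Finsupp.sum_add])
    (fun c v w => by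
      simp only [RingHom.id_apply, Finsupp.smul_sum]
      exact Finsupp.sum_congr (by intros; simp [mul_left_comm]))

/-- Annihilation operator of the oscillator `i`: `|μ⟩ ↦ √μ_i |μ - e_i⟩` (zero if `μ_i = 0`). -/
def lower {n : ℕ} (i : Fin n ⊕ Fin n) : Module.End ℂ (Fock n) :=
  Finsupp.linearCombination ℂ fun μ : Occ n =>
    (Real.sqrt (μ i) : ℂ) • ket (μ - Finsupp.single i 1)

/-- Creation operator of the oscillator `i`: `|μ⟩ ↦ √(μ_i + 1) |μ + e_i⟩`. -/
def raise {n : ℕ} (i : Fin n ⊕ Fin n) : Module.End ℂ (Fock n) :=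
  Finsupp.linearCombination ℂ fun μ : Occ n =>
    (Real.sqrt (μ i + 1) : ℂ) • ket (μ + Finsupp.single i 1)

section Operators

variable {n : ℕ}

/-- `A_a` -/
def opA (a : Fin n) : Module.End ℂ (Fock n) := lower (Sum.inl a)
/-- `B_a` -/
def opB (a : Fin n) : Module.End ℂ (Fock n) := lower (Sum.inr a)
/-- `A†_a` -/
def opAd (a : Fin n) : Module.End ℂ (Fock n) := raise (Sum.inl a)
/-- `B†_a` -/
def opBd (a : Fin n) : Module.End ℂ (Fock n) := raise (Sum.inr a)

/-- `E_ab = A†_a A_b + B†_a B_b + δ_ab` -/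
def opE (a b : Fin n) : Module.End ℂ (Fock n) :=
  opAd a * opA b + opBd a * opB b + if a = b then 1 else 0

/-- `F_ab = B_a A_b - A_a B_b` -/
def opF (a b : Fin n) : Module.End ℂ (Fock n) := opB a * opA b - opA a * opB b

/-- `F̃_ab = B†_a A†_b - A†_a B†_b` -/
def opFt (a b : Fin n) : Module.End ℂ (Fock n) := opBd a * opAd b - opAd a * opBd b

end Operators

/-! ### `SU(2)` and intertwiners -/

/-- `J_z = ∑_a (A†_a A_a - B†_a B_a) / 2` -/
def opJz (n : ℕ) : Module.End ℂ (Fock n) :=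
  ∑ a : Fin n, (1 / 2 : ℂ) • (opAd a * opA a - opBd a * opB a)

/-- `J_+ = ∑_a A†_a B_a` -/
def opJp (n : ℕ) : Module.End ℂ (Fock n) := ∑ a : Fin n, opAd a * opB a

/-- `J_- = ∑_a B†_a A_a` -/
def opJm (n : ℕ) : Module.End ℂ (Fock n) := ∑ a : Fin n, opBd a * opA a

/-- A scalar operator for `SU(2)`: it commutes with the total angular momentum. -/
def IsScalarOp {n : ℕ} (T : Module.End ℂ (Fock n)) : Prop :=
  Commute (opJz n) T ∧ Commute (opJp n) T ∧ Commute (opJm n) T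

/-- The vectors annihilated by the total angular momentum. -/
def invariants (n : ℕ) : Submodule ℂ (Fock n) :=
  LinearMap.ker (opJz n) ⊓ LinearMap.ker (opJp n) ⊓ LinearMap.ker (opJm n)

/-- The space `F_{j_1} ⊗ ⋯ ⊗ F_{j_n}` with `k a = 2 j_a`, in the oscillator realisation: it is
spanned by the vectors `|j_1,m_1⟩ ⊗ ⋯ ⊗ |j_n,m_n⟩`, where `|j,m⟩` has `j + m` quanta of the
oscillator `A` and `j - m` quanta of the oscillator `B`. -/
def legSpace {n : ℕ} (k : Fin n → ℕ) : Submodule ℂ (Fock n) :=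
  Submodule.span ℂ {v | ∃ μ : Occ n, (∀ a, μ (Sum.inl a) + μ (Sum.inr a) = k a) ∧ v = ket μ}

/-- `Inv_{SU(2)} (F_{j_1} ⊗ ⋯ ⊗ F_{j_n})` with `k a = 2 j_a`. -/
def invLeg {n : ℕ} (k : Fin n → ℕ) : Submodule ℂ (Fock n) := legSpace k ⊓ invariants n

/-- The space `H_n^J` of `n`-valent intertwiners with total area `∑_a j_a = J`. -/
def areaSpace (n J : ℕ) : Submodule ℂ (Fock n) :=
  ⨆ k : {k : Fin n → ℕ // ∑ a, k a = 2 * J}, invLeg k.1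

/-- The space `H_n = ⨁_J H_n^J` of all `n`-valent intertwiners. -/
def intertwinerSpace (n : ℕ) : Submodule ℂ (Fock n) := ⨆ J : ℕ, areaSpace n J

/-! ### The group `SO*(2n)`, its maximal compact subgroup and its Lie algebra -/

/-- Complex `2n × 2n` matrices. -/
abbrev Mat2 (n : ℕ) : Type := Matrix (Fin n ⊕ Fin n) (Fin n ⊕ Fin n) ℂ

/-- The matrix `diag(1, -1)` of the Hermitian form of signature `(n, n)`. -/
def hermForm (n : ℕ) : Mat2 n := fromBlocks 1 0 0 (-1)

/-- The matrix of the symmetric bilinear form `∑_a (x_a y_{n+a} + y_a x_{n+a})`. -/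
def symmForm (n : ℕ) : Mat2 n := fromBlocks 0 1 1 0

/-- The group `SO*(2n)`: the elements of `SU(n,n)` that preserve the symmetric form. -/
def group (n : ℕ) : Subgroup (Mat2 n)ˣ where
  carrier := {g | (g : Mat2 n).det = 1 ∧
    (g : Mat2 n)ᴴ * hermForm n * (g : Mat2 n) = hermForm n ∧
    (g : Mat2 n)ᵀ * symmForm n * (g : Mat2 n) = symmForm n}
  one_mem' := by simp
  mul_mem' := by
    rintro g h ⟨g1, g2, g3⟩ ⟨h1, h2, h3⟩
    refine ⟨by simp [g1, h1], ?_, ?_⟩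
    · calc _ = (h : Mat2 n)ᴴ * ((g : Mat2 n)ᴴ * hermForm n * (g : Mat2 n)) * (h : Mat2 n) := by
            simp [conjTranspose_mul, Matrix.mul_assoc]
        _ = _ := by rw [g2, h2]
    · calc _ = (h : Mat2 n)ᵀ * ((g : Mat2 n)ᵀ * symmForm n * (g : Mat2 n)) * (h : Mat2 n) := by
            simp [transpose_mul, Matrix.mul_assoc]
        _ = _ := by rw [g3, h3]
  inv_mem' := by
    rintro g ⟨g1, g2, g3⟩
    have e : (g : Mat2 n) * ((g⁻¹ : (Mat2 n)ˣ) : Mat2 n) = 1 := by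
      rw [← Units.val_mul]; simp
    have e1 : ((g⁻¹ : (Mat2 n)ˣ) : Mat2 n)ᴴ * (g : Mat2 n)ᴴ = 1 := by
      rw [← conjTranspose_mul, e]; simp
    have e2 : ((g⁻¹ : (Mat2 n)ˣ) : Mat2 n)ᵀ * (g : Mat2 n)ᵀ = 1 := by
      rw [← transpose_mul, e]; simp
    refine ⟨?_, ?_, ?_⟩
    · have := congrArg Matrix.det e
      rw [det_mul, g1, det_one, one_mul] at this
      exact this
    · calc _ = ((g⁻¹ : (Mat2 n)ˣ) : Mat2 n)ᴴ *
              ((g : Mat2 n)ᴴ * hermForm n * (g : Mat2 n)) * ((g⁻¹ : (Mat2 n)ˣ) : Mat2 n) := by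
            rw [g2]
        _ = (((g⁻¹ : (Mat2 n)ˣ) : Mat2 n)ᴴ * (g : Mat2 n)ᴴ) * hermForm n *
              ((g : Mat2 n) * ((g⁻¹ : (Mat2 n)ˣ) : Mat2 n)) := by
            simp only [Matrix.mul_assoc]
        _ = _ := by rw [e1, e]; simp
    · calc _ = ((g⁻¹ : (Mat2 n)ˣ) : Mat2 n)ᵀ *
              ((g : Mat2 n)ᵀ * symmForm n * (g : Mat2 n)) * ((g⁻¹ : (Mat2 n)ˣ) : Mat2 n) := by
            rw [g3]
        _ = (((g⁻¹ : (Mat2 n)ˣ) : Mat2 n)ᵀ * (g : Mat2 n)ᵀ) * symmForm n *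
              ((g : Mat2 n) * ((g⁻¹ : (Mat2 n)ˣ) : Mat2 n)) := by
            simp only [Matrix.mul_assoc]
        _ = _ := by rw [e2, e]; simp

/-- The maximal compact subgroup `K` of `SO*(2n)`: the elements of the form `diag(U, conj U)`
with `U` in `U(n)`. -/
def maxCompact (n : ℕ) : Subgroup (group n) where
  carrier := {g | ∃ U ∈ Matrix.unitaryGroup (Fin n) ℂ,
    ((g : (Mat2 n)ˣ) : Mat2 n) = fromBlocks U 0 0 (U.map conj)}
  one_mem' := ⟨1, one_mem _, by simp⟩
  mul_mem' := by
    rintro g h ⟨U, hU, gU⟩ ⟨W, hW, hW'⟩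
    refine ⟨U * W, mul_mem hU hW, ?_⟩
    simp [gU, hW', fromBlocks_multiply, Matrix.map_mul]
  inv_mem' := by
    rintro g ⟨U, hU, gU⟩
    refine ⟨star U, Unitary.star_mem hU, ?_⟩
    have h1 : star U * U = 1 := Unitary.star_mul_self_of_mem hU
    have h2 : (star U).map conj * U.map conj = 1 := by
      rw [← Matrix.map_mul, h1]; simp
    have h3 : fromBlocks (star U) 0 0 ((star U).map conj) * ((g : (Mat2 n)ˣ) : Mat2 n) = 1 := by
      rw [gU]; simp [fromBlocks_multiply, h1, h2]
    have h4 : (((g : (Mat2 n)ˣ)⁻¹ : (Mat2 n)ˣ) : Mat2 n)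
        = fromBlocks (star U) 0 0 ((star U).map conj) := by
      rw [← one_mul (((g : (Mat2 n)ˣ)⁻¹ : (Mat2 n)ˣ) : Mat2 n), ← h3, Matrix.mul_assoc,
        ← Units.val_mul]
      simp
    exact h4

/-- The real Lie algebra `so*(2n)`: the elements of `su(n,n)` that are infinitesimal
symmetries of the symmetric form. -/
def lieAlg (n : ℕ) : LieSubalgebra ℝ (Mat2 n) where
  carrier := {V | V.trace = 0 ∧ Vᴴ * hermForm n = -(hermForm n * V) ∧
    Vᵀ * symmForm n = -(symmForm n * V)}
  zero_mem' := by simp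
  add_mem' := by
    rintro V W ⟨v1, v2, v3⟩ ⟨w1, w2, w3⟩
    refine ⟨by simp [v1, w1], ?_, ?_⟩
    · rw [conjTranspose_add, Matrix.add_mul, v2, w2, Matrix.mul_add]; abel
    · rw [transpose_add, Matrix.add_mul, v3, w3, Matrix.mul_add]; abel
  smul_mem' := by
    rintro c V ⟨v1, v2, v3⟩
    refine ⟨by simp [v1], ?_, ?_⟩
    · simp [conjTranspose_smul, v2]
    · simp [transpose_smul, v3]
  lie_mem' := by
    rintro V W ⟨v1, v2, v3⟩ ⟨w1, w2, w3⟩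
    refine ⟨?_, ?_, ?_⟩
    · rw [Ring.lie_def, trace_sub, trace_mul_comm, sub_self]
    · rw [Ring.lie_def, conjTranspose_sub, conjTranspose_mul, conjTranspose_mul, Matrix.sub_mul,
        Matrix.mul_assoc, Matrix.mul_assoc, v2, w2, Matrix.mul_neg, Matrix.mul_neg,
        ← Matrix.mul_assoc, ← Matrix.mul_assoc, v2, w2, Matrix.mul_sub]
      simp only [Matrix.neg_mul, Matrix.mul_assoc, neg_neg]; abel
    · rw [Ring.lie_def, transpose_sub, transpose_mul, transpose_mul, Matrix.sub_mul,
        Matrix.mul_assoc, Matrix.mul_assoc, v3, w3, Matrix.mul_neg, Matrix.mul_neg,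
        ← Matrix.mul_assoc, ← Matrix.mul_assoc, v3, w3, Matrix.mul_sub]
      simp only [Matrix.neg_mul, Matrix.mul_assoc, neg_neg]; abel

/-- The matrix underlying an element of the maximal compact subgroup. -/
def kMat {n : ℕ} (k : maxCompact n) : Mat2 n := (((k : group n) : (Mat2 n)ˣ) : Mat2 n)

/-- `(𝔤, K)`-modules for `G = SO*(2n)`: a `𝔤`-module and `K`-module structure on a complex vector
space such that `k X v = Ad(k)X k v`, every `v` is `K`-finite with `K` acting continuously on the
finite-dimensional span of `K v`, and the derivative of the action of `K` is that of its Lie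
algebra. Since the span of `K v` is finite dimensional, continuity and derivatives can be tested
on linear functionals. -/
structure GKModule (n : ℕ) (M : Type) [AddCommGroup M] [Module ℂ M] where
  /-- the action of `𝔤` -/
  lieAction : lieAlg n →ₗ⁅ℝ⁆ Module.End ℂ M
  /-- the action of `K` -/
  compactAction : maxCompact n →* Module.End ℂ M
  ad_compat : ∀ (k : maxCompact n) (X : lieAlg n), ∃ Y : lieAlg n,
    (Y : Mat2 n) = kMat k * (X : Mat2 n) * kMat k⁻¹ ∧
    compactAction k * lieAction X = lieAction Y * compactAction k
  finite : ∀ v : M,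
    FiniteDimensional ℂ (Submodule.span ℂ (Set.range fun k : maxCompact n => compactAction k v))
  continuous : ∀ (v : M) (f : M →ₗ[ℂ] ℂ), Continuous fun k : maxCompact n => f (compactAction k v)
  deriv : ∀ (Y : lieAlg n) (γ : ℝ → maxCompact n),
    (∀ t : ℝ, kMat (γ t) = NormedSpace.exp (t • (Y : Mat2 n))) →
    ∀ (v : M) (f : M →ₗ[ℂ] ℂ),
      HasDerivAt (fun t : ℝ => f (compactAction (γ t) v)) (f (lieAction Y v)) 0

/-- The `(𝔤, K)`-module is unitary with respect to the given inner product: the latter is a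
positive definite Hermitian form, `𝔤` acts by skew-adjoint operators and `K` by unitary ones. -/
structure GKModule.IsUnitary {n : ℕ} {M : Type} [AddCommGroup M] [Module ℂ M]
    (π : GKModule n M) (form : M →ₗ⋆[ℂ] M →ₗ[ℂ] ℂ) : Prop where
  hermitian : ∀ v w, conj (form v w) = form w v
  pos : ∀ v, v ≠ 0 → 0 < (form v v).re
  skew : ∀ X v w, form (π.lieAction X v) w = -form v (π.lieAction X w)
  unitary : ∀ k v w, form (π.compactAction k v) (π.compactAction k w) = form v w

/-- The `(𝔤, K)`-module is irreducible. -/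
def GKModule.IsIrreducible {n : ℕ} {M : Type} [AddCommGroup M] [Module ℂ M]
    (π : GKModule n M) : Prop :=
  Nontrivial M ∧ ∀ W : Submodule ℂ M,
    (∀ X, ∀ v ∈ W, π.lieAction X v ∈ W) → (∀ k, ∀ v ∈ W, π.compactAction k v ∈ W) →
    W = ⊥ ∨ W = ⊤

/-- The operator by which the matrix `(X Y; Z -Xᵀ)` (with `Y`, `Z` antisymmetric) acts when the
matrices `(Δ_ab 0; 0 -Δ_ba)`, `(0 0; Δ_ab - Δ_ba 0)` and `(0 Δ_ab - Δ_ba; 0 0)`, which span the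
complexification of `so*(2n)`, act as `E_ab`, `F_ab` and `F̃_ab` respectively; the factors `1/2`
are there because the antisymmetric matrices `Δ_ab - Δ_ba` are summed over all `a, b`. -/
def opOf {n : ℕ} (V : Mat2 n) : Module.End ℂ (Fock n) :=
  ∑ a : Fin n, ∑ b : Fin n,
    (V (Sum.inl a) (Sum.inl b) • opE a b
      + ((1 / 2 : ℂ) * V (Sum.inr a) (Sum.inl b)) • opF a b
      + ((1 / 2 : ℂ) * V (Sum.inl a) (Sum.inr b)) • opFt a b)

/-- The commutation relations of `so*(2n)_ℂ` (for elements of an associative ring, with the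
commutator `⁅x, y⁆ = x * y - y * x`). -/
structure Relations {n : ℕ} {L : Type} [Ring L] (E F Ft : Fin n → Fin n → L) : Prop where
  E_E : ∀ a b c d, ⁅E a b, E c d⁆ = (if c = b then E a d else 0) - (if a = d then E c b else 0)
  E_Ft : ∀ a b c d,
    ⁅E a b, Ft c d⁆ = (if b = c then Ft a d else 0) - (if b = d then Ft a c else 0)
  E_F : ∀ a b c d, ⁅E a b, F c d⁆ = (if a = d then F b c else 0) - (if a = c then F b d else 0)
  F_Ft : ∀ a b c d, ⁅F a b, Ft c d⁆ = (if d = b then E c a else 0) + (if c = a then E d b else 0)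
    - (if c = b then E d a else 0) - (if d = a then E c b else 0)
  F_F : ∀ a b c d, ⁅F a b, F c d⁆ = 0
  Ft_Ft : ∀ a b c d, ⁅Ft a b, Ft c d⁆ = 0
  F_antisymm : ∀ a b, F b a = -F a b
  Ft_antisymm : ∀ a b, Ft b a = -Ft a b

/-- `v` is a highest weight vector of weight `[l_1, …, l_n]` for the action of `𝔲(n)_ℂ` by the
operators `E_ab`. -/
def IsHighestWeight {n : ℕ} (l : Fin n → ℂ) (v : Fock n) : Prop :=
  v ≠ 0 ∧ (∀ a, opE a a v = l a • v) ∧ ∀ a b, a < b → opE a b v = 0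

/-- `|ψ_J⟩ = (J! (J+1)!)^{-1/2} (F̃_12)^J |0⟩`. -/
def psi {n : ℕ} (hn : 2 ≤ n) (J : ℕ) : Fock n :=
  ((Real.sqrt ((J.factorial : ℝ) * ((J + 1).factorial : ℝ)))⁻¹ : ℂ) •
    ((opFt (⟨0, by omega⟩ : Fin n) ⟨1, by omega⟩) ^ J) (vacuum n)

end SOStar

end

/-!
All the operators involved are quadratic in the oscillators, so the commutation relations are
instances of the fact that `V ↦ ∑ V_ij c_i d_j` is a Lie algebra homomorphism as soon as
`[d_i, c_j] = δ_ij`. For `E`, `F` and `F̃` one takes `c = (A†, B)` and `d = (A, -B†)`; for the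
compact group it is more convenient that `diag(U, Ū)` acts by `det U` times the second quantisation
of `U`, that is by substitution in polynomials.

The irreducibility statements rest on a Capelli identity: `∑_ab F̃_ab F_ab` acts on the intertwiners
of total area `J` as the scalar `2 J (J + 1)`. Hence every intertwiner is obtained from vectors with
fewer quanta by applying `F̃_ab`, and only multiples of the vacuum are annihilated by all `F_ab`. A
subspace stable under all `F_ab` is therefore zero or contains the vacuum, and if it is also stable
under all `F̃_ab` it then contains everything.

A highest weight vector of fixed total area `J` involves only the first two pairs of oscillators, so
for it the Capelli identity reduces to a multiple of `F̃_12 F_12`, and by induction on `J` it is a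
multiple of `F̃_12^J |0⟩`. Every nonzero subspace stable under all `E_ab` contains a highest weight
vector; a proper one and its orthogonal complement would both contain `ψ_J`.
-/

noncomputable section

namespace SOStar

/-! ### Canonical commutation relations -/

section Commutator

variable {L : Type*} [Ring L]

lemma lie_mul_eq (x y z : L) : ⁅x, y * z⁆ = ⁅x, y⁆ * z + y * ⁅x, z⁆ := by
  simp only [Ring.lie_def]
  noncomm_ring

lemma mul_lie_eq (x y z : L) : ⁅x * y, z⁆ = ⁅x, z⁆ * y + x * ⁅y, z⁆ := by
  simp only [Ring.lie_def]
  noncomm_ring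

lemma lie_ite_one (p : Prop) [Decidable p] (x : L) : ⁅x, (if p then 1 else 0 : L)⁆ = 0 := by
  split_ifs <;> simp [Ring.lie_def]

lemma ite_one_lie (p : Prop) [Decidable p] (x : L) : ⁅(if p then 1 else 0 : L), x⁆ = 0 := by
  split_ifs <;> simp [Ring.lie_def]

end Commutator

/-- The canonical commutation relations between creation operators `c i` and annihilation
operators `d i`, for elements of an arbitrary ring. -/
structure CCR {L σ : Type*} [Ring L] [DecidableEq σ] (c d : σ → L) : Prop where
  lie_d_c : ∀ i j, ⁅d i, c j⁆ = if i = j then 1 else 0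
  lie_c_c : ∀ i j, ⁅c i, c j⁆ = 0
  lie_d_d : ∀ i j, ⁅d i, d j⁆ = 0

namespace CCR

variable {L σ : Type*} [Ring L] [DecidableEq σ] {c d : σ → L}

lemma d_mul_c (h : CCR c d) (i j : σ) : d i * c j = c j * d i + if i = j then 1 else 0 := by
  rw [← h.lie_d_c, Ring.lie_def]
  abel

lemma c_mul_c (h : CCR c d) (i j : σ) : c i * c j = c j * c i :=
  commute_iff_lie_eq.2 (h.lie_c_c i j)

lemma d_mul_d (h : CCR c d) (i j : σ) : d i * d j = d j * d i :=
  commute_iff_lie_eq.2 (h.lie_d_d i j)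

lemma lie_c_d (h : CCR c d) (i j : σ) : ⁅c i, d j⁆ = if j = i then -1 else 0 := by
  rw [← lie_skew, h.lie_d_c]
  split_ifs <;> simp

end CCR

/-- The quadratic expression `∑ X_ij c_i d_j` in two families of elements of an algebra, which
represents the matrix `X` by operators when `c` and `d` satisfy the canonical commutation
relations. -/
def quad {R A σ : Type*} [CommRing R] [Ring A] [Algebra R A] [Fintype σ] (c d : σ → A)
    (X : Matrix σ σ R) : A :=
  ∑ i, ∑ j, X i j • (c i * d j)

section Quad

variable {R A σ : Type*} [CommRing R] [Ring A] [Algebra R A] [Fintype σ] {c d : σ → A}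

lemma quad_sub (X Y : Matrix σ σ R) : quad c d (X - Y) = quad c d X - quad c d Y := by
  simp only [quad, Matrix.sub_apply, sub_smul, Finset.sum_sub_distrib]

lemma quad_one [DecidableEq σ] : quad c d (1 : Matrix σ σ R) = ∑ i, c i * d i := by
  simp [quad, Matrix.one_apply, ite_smul]

lemma CCR.lie_quad_c [DecidableEq σ] (h : CCR c d) (X : Matrix σ σ R) (j : σ) :
    ⁅quad c d X, c j⁆ = ∑ i, X i j • c i := by
  simp [quad, sum_lie, mul_lie_eq, h.lie_d_c, h.lie_c_c]

lemma CCR.lie_quad_d [DecidableEq σ] (h : CCR c d) (X : Matrix σ σ R) (j : σ) :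
    ⁅quad c d X, d j⁆ = -∑ i, X j i • d i := by
  simp [quad, sum_lie, mul_lie_eq, h.lie_c_d, h.lie_d_d]

lemma quad_matrix_mul_left (K X : Matrix σ σ R) :
    quad c d (K * X) = quad (fun j => ∑ i, K i j • c i) d X := by
  simp only [quad, Matrix.mul_apply, Finset.sum_smul, Finset.sum_mul, Finset.smul_sum,
    smul_mul_assoc, smul_smul]
  rw [← Finset.sum_comm_cycle, Finset.sum_comm]
  simp only [mul_comm]

lemma quad_matrix_mul_right (X K : Matrix σ σ R) :
    quad c d (X * K) = quad c (fun i => ∑ j, K i j • d j) X := by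
  simp only [quad, Matrix.mul_apply, Finset.sum_smul, Finset.mul_sum, Finset.smul_sum,
    mul_smul_comm, smul_smul]
  exact Finset.sum_congr rfl fun i _ => Finset.sum_comm

lemma lie_quad (x : A) (X : Matrix σ σ R) :
    ⁅x, quad c d X⁆ = quad (fun i => ⁅x, c i⁆) d X + quad c (fun j => ⁅x, d j⁆) X := by
  have lie_smul (a : R) (y : A) : ⁅x, a • y⁆ = a • ⁅x, y⁆ := _root_.lie_smul a x y
  simp only [quad, lie_sum, lie_smul, lie_mul_eq, smul_add, Finset.sum_add_distrib]

lemma CCR.lie_quad_quad [DecidableEq σ] (h : CCR c d) (X Y : Matrix σ σ R) :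
    ⁅quad c d X, quad c d Y⁆ = quad c d ⁅X, Y⁆ := by
  have hneg : quad c (fun j => -∑ i, X j i • d i) Y = -quad c (fun j => ∑ i, X j i • d i) Y := by
    simp only [quad, mul_neg, smul_neg, Finset.sum_neg_distrib]
  simp only [lie_quad _ Y, h.lie_quad_c, h.lie_quad_d, hneg]
  rw [← quad_matrix_mul_left, ← quad_matrix_mul_right, Ring.lie_def, quad_sub, sub_eq_add_neg]

lemma mul_quad_of_intertwining {T : A} {K K' : Matrix σ σ R}
    (hc : ∀ j, T * c j = (∑ i, K i j • c i) * T)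
    (hd : ∀ j, T * d j = (∑ i, K' j i • d i) * T) (X : Matrix σ σ R) :
    T * quad c d X = quad c d (K * X * K') * T := by
  have hcd (i j : σ) :
      T * (c i * d j) = (∑ k, K k i • c k) * (∑ l, K' j l • d l) * T := by
    rw [← mul_assoc, hc, mul_assoc, hd, ← mul_assoc]
  rw [quad_matrix_mul_right, quad_matrix_mul_left, quad, quad]
  simp only [Finset.mul_sum _ _ T, Finset.sum_mul _ _ T, mul_smul_comm, smul_mul_assoc, hcd]

end Quad

/-! ### Bilinear expressions in two species of oscillators -/

section BilinearGenerators

variable {L ι : Type*} [Ring L]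

/-- The generator `E_ab = c_a d_b + c'_a d'_b + δ_ab` of `𝔤𝔩(ι)` in two species of oscillators,
indexed by the two summands of `ι ⊕ ι`. -/
def unitaryGen [DecidableEq ι] (c d : ι ⊕ ι → L) (a b : ι) : L :=
  c (.inl a) * d (.inl b) + c (.inr a) * d (.inr b) + if a = b then 1 else 0

/-- The `SU(2)`-singlet `x'_a x_b - x_a x'_b` of two doublets `(x_a, x'_a)` and `(x_b, x'_b)`:
this is `F_ab` for annihilation operators and `F̃_ab` for creation operators. -/
def singletPair (x : ι ⊕ ι → L) (a b : ι) : L :=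
  x (.inr a) * x (.inl b) - x (.inl a) * x (.inr b)

/-- The traceless matrix `(p q; r -p)`, acting on the two species of oscillators. -/
def sl2Matrix (ι : Type*) [DecidableEq ι] (p q r : L) : Matrix (ι ⊕ ι) (ι ⊕ ι) L :=
  fromBlocks (p • 1) (q • 1) (r • 1) (-(p • 1))

end BilinearGenerators

lemma CCR.relations {n : ℕ} {L : Type} [Ring L] {c d : Fin n ⊕ Fin n → L} (h : CCR c d) :
    Relations (unitaryGen c d) (singletPair d) (singletPair c) where
  E_E a b e f := by
    simp only [unitaryGen, lie_mul_eq, mul_lie_eq, add_lie, lie_add, lie_ite_one, ite_one_lie,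
      h.lie_c_c, h.lie_d_d, h.lie_c_d, h.lie_d_c, Sum.inl.injEq, Sum.inr.injEq, reduceCtorEq,
      if_false]
    by_cases h1 : b = e <;> by_cases h2 : a = f <;> simp [h1, h2, eq_comm] <;> abel_nf
  E_Ft a b e f := by
    simp only [unitaryGen, singletPair, lie_mul_eq, mul_lie_eq, add_lie, lie_sub, ite_one_lie,
      h.lie_c_c, h.lie_d_c, Sum.inl.injEq, Sum.inr.injEq, reduceCtorEq, if_false,
      h.c_mul_c (.inl _) (.inr _)]
    split_ifs <;> subst_vars <;> simp
  E_F a b e f := by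
    simp only [unitaryGen, singletPair, lie_mul_eq, mul_lie_eq, add_lie, lie_sub, ite_one_lie,
      h.lie_d_d, h.lie_c_d, Sum.inl.injEq, Sum.inr.injEq, reduceCtorEq, if_false]
    split_ifs <;> subst_vars <;> simp_all [h.d_mul_d (.inl _) (.inr _)] <;> abel
  F_Ft a b e f := by
    simp only [unitaryGen, singletPair, lie_mul_eq, mul_lie_eq, sub_lie, lie_sub, h.lie_d_c,
      Sum.inl.injEq, Sum.inr.injEq, reduceCtorEq, if_false]
    split_ifs <;> subst_vars <;> simp_all [h.d_mul_c] <;> abel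
  F_F a b e f := by
    simp [singletPair, lie_mul_eq, mul_lie_eq, sub_lie, lie_sub, h.lie_d_d]
  Ft_Ft a b e f := by
    simp [singletPair, lie_mul_eq, mul_lie_eq, sub_lie, lie_sub, h.lie_c_c]
  F_antisymm a b := by
    rw [singletPair, singletPair, h.d_mul_d (.inr b), h.d_mul_d (.inl b)]
    abel
  Ft_antisymm a b := by
    rw [singletPair, singletPair, h.c_mul_c (.inr b), h.c_mul_c (.inl b)]
    abel

section Invariance

variable {R A ι : Type*} [CommRing R] [Ring A] [Algebra R A]

lemma lie_singletPair_eq_zero {p q r : R} {T : A} {x : ι ⊕ ι → A}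
    (hl : ∀ a, ⁅T, x (.inl a)⁆ = p • x (.inl a) + r • x (.inr a))
    (hr : ∀ a, ⁅T, x (.inr a)⁆ = q • x (.inl a) - p • x (.inr a)) (a b : ι) :
    ⁅T, singletPair x a b⁆ = 0 := by
  simp only [singletPair, lie_sub, lie_mul_eq, hl, hr, mul_add, mul_sub, add_mul, sub_mul,
    smul_mul_assoc, mul_smul_comm]
  abel

variable [Fintype ι] [DecidableEq ι] {c d : ι ⊕ ι → A} (p q r : R)

lemma quad_sl2Matrix : quad c d (sl2Matrix ι p q r) =
    ∑ a, p • (c (.inl a) * d (.inl a) - c (.inr a) * d (.inr a)) +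
      q • ∑ a, c (.inl a) * d (.inr a) + r • ∑ a, c (.inr a) * d (.inl a) := by
  simp only [quad, sl2Matrix, Fintype.sum_sum_type, fromBlocks_apply₁₁, fromBlocks_apply₁₂,
    fromBlocks_apply₂₁, fromBlocks_apply₂₂, Matrix.smul_apply, Matrix.neg_apply, Matrix.one_apply,
    smul_eq_mul, mul_ite, mul_one, mul_zero, ite_smul, zero_smul, neg_smul,
    Finset.sum_add_distrib, Finset.sum_neg_distrib, Finset.sum_ite_eq, Finset.mem_univ, if_true,
    ← Finset.smul_sum, Finset.sum_sub_distrib]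
  module

variable {p q r} in
lemma commute_quad_sl2Matrix {T : A}
    (hT : ∀ i j, Sum.elim id id i = Sum.elim id id j → Commute (c i * d j) T) :
    Commute (quad c d (sl2Matrix ι p q r)) T := by
  rw [quad_sl2Matrix]
  refine .add_left (.add_left (.sum_left _ _ _ fun a _ => .smul_left (.sub_left ?_ ?_) p)
    (.smul_left (.sum_left _ _ _ fun a _ => ?_) q)) (.smul_left (.sum_left _ _ _ fun a _ => ?_) r)
    <;> exact hT _ _ rfl

variable (h : CCR c d) (a b : ι)
include h

lemma CCR.lie_sl2_c_inl :
    ⁅quad c d (sl2Matrix ι p q r), c (.inl a)⁆ = p • c (.inl a) + r • c (.inr a) := by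
  simp [h.lie_quad_c, sl2Matrix, Matrix.one_apply]

lemma CCR.lie_sl2_c_inr :
    ⁅quad c d (sl2Matrix ι p q r), c (.inr a)⁆ = q • c (.inl a) - p • c (.inr a) := by
  simp [h.lie_quad_c, sl2Matrix, Matrix.one_apply, sub_eq_add_neg]

lemma CCR.lie_sl2_d_inl :
    ⁅quad c d (sl2Matrix ι p q r), d (.inl a)⁆ = -p • d (.inl a) + -q • d (.inr a) := by
  simp [h.lie_quad_d, sl2Matrix, Matrix.one_apply, add_comm]

lemma CCR.lie_sl2_d_inr :
    ⁅quad c d (sl2Matrix ι p q r), d (.inr a)⁆ = -r • d (.inl a) - -p • d (.inr a) := by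
  simp [h.lie_quad_d, sl2Matrix, Matrix.one_apply, add_comm]

lemma CCR.commute_sl2_unitaryGen :
    Commute (quad c d (sl2Matrix ι p q r)) (unitaryGen c d a b) := by
  simp only [commute_iff_lie_eq, unitaryGen, lie_add, lie_mul_eq, lie_ite_one, h.lie_sl2_c_inl,
    h.lie_sl2_c_inr, h.lie_sl2_d_inl, h.lie_sl2_d_inr, mul_add, mul_sub, add_mul, sub_mul,
    smul_mul_assoc, mul_smul_comm, neg_smul, mul_neg]
  abel

lemma CCR.commute_sl2_singletPair_d :
    Commute (quad c d (sl2Matrix ι p q r)) (singletPair d a b) :=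
  commute_iff_lie_eq.2 (lie_singletPair_eq_zero (h.lie_sl2_d_inl p q r) (h.lie_sl2_d_inr p q r) a b)

lemma CCR.commute_sl2_singletPair_c :
    Commute (quad c d (sl2Matrix ι p q r)) (singletPair c a b) :=
  commute_iff_lie_eq.2 (lie_singletPair_eq_zero (h.lie_sl2_c_inl p q r) (h.lie_sl2_c_inr p q r) a b)

lemma CCR.lie_quad_one_c (i : ι ⊕ ι) : ⁅quad c d (1 : Matrix _ _ R), c i⁆ = c i := by
  simp [h.lie_quad_c, Matrix.one_apply]

lemma CCR.lie_quad_one_d (i : ι ⊕ ι) : ⁅quad c d (1 : Matrix _ _ R), d i⁆ = -d i := by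
  simp [h.lie_quad_d, Matrix.one_apply]

lemma CCR.lie_quad_one_unitaryGen : ⁅quad c d (1 : Matrix _ _ R), unitaryGen c d a b⁆ = 0 := by
  simp [unitaryGen, lie_mul_eq, lie_ite_one, h.lie_quad_one_c, h.lie_quad_one_d]

lemma CCR.lie_quad_one_singletPair_d :
    ⁅quad c d (1 : Matrix _ _ R), singletPair d a b⁆ = (-2 : R) • singletPair d a b := by
  simp only [singletPair, lie_sub, lie_mul_eq, h.lie_quad_one_d, neg_mul, mul_neg]
  module

lemma CCR.lie_quad_one_singletPair_c :
    ⁅quad c d (1 : Matrix _ _ R), singletPair c a b⁆ = (2 : R) • singletPair c a b := by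
  simp only [singletPair, lie_sub, lie_mul_eq, h.lie_quad_one_c]
  module

end Invariance

section RingIdentities

variable {L ι : Type*} [Ring L] [DecidableEq ι] {c d : ι ⊕ ι → L}

lemma CCR.commute_d_singletPair_d (h : CCR c d) (i : ι ⊕ ι) (a b : ι) :
    Commute (d i) (singletPair d a b) := by
  simp [commute_iff_lie_eq, singletPair, lie_mul_eq, h.lie_d_d]

lemma CCR.singletPair_mul_d_inl (h : CCR c d) {a a' b : ι} (hab : a ≠ b) (hab' : a' ≠ b) :
    singletPair c a a' * d (.inl b) =
      c (.inr a) * unitaryGen c d a' b - c (.inr a') * unitaryGen c d a b := by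
  simp only [singletPair, unitaryGen, if_neg hab, if_neg hab', add_zero, mul_add, sub_mul,
    ← mul_assoc, h.c_mul_c (.inl a) (.inr a'), h.c_mul_c (.inr a) (.inr a')]
  abel

lemma CCR.singletPair_mul_d_inr (h : CCR c d) {a a' b : ι} (hab : a ≠ b) (hab' : a' ≠ b) :
    singletPair c a a' * d (.inr b) =
      c (.inl a') * unitaryGen c d a b - c (.inl a) * unitaryGen c d a' b := by
  simp only [singletPair, unitaryGen, if_neg hab, if_neg hab', add_zero, mul_add, sub_mul,
    ← mul_assoc, h.c_mul_c (.inl a') (.inr a), h.c_mul_c (.inl a') (.inl a)]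
  abel

end RingIdentities

lemma CCR.sum_singletPair_mul_singletPair {L ι : Type*} [Ring L] [Fintype ι] [DecidableEq ι]
    {c d : ι ⊕ ι → L} (h : CCR c d) :
    ∑ a, ∑ b, singletPair c a b * singletPair d a b =
      2 * ((∑ a, c (.inr a) * d (.inr a)) * (∑ a, c (.inl a) * d (.inl a))
        - (∑ a, c (.inr a) * d (.inl a)) * (∑ a, c (.inl a) * d (.inr a))
        + ∑ a, c (.inr a) * d (.inr a)) := by
  have hnum : (∑ a, c (.inr a) * d (.inr a)) * (∑ a, c (.inl a) * d (.inl a)) =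
      ∑ a, ∑ b, c (.inr a) * c (.inl b) * (d (.inr a) * d (.inl b)) := by
    rw [Finset.sum_mul_sum]
    refine Finset.sum_congr rfl fun a _ => Finset.sum_congr rfl fun b _ => ?_
    rw [mul_assoc, ← mul_assoc (d _), h.d_mul_c]
    simp [mul_assoc]
  have hhop : (∑ a, c (.inr a) * d (.inl a)) * (∑ a, c (.inl a) * d (.inr a)) =
      ∑ a, ∑ b, c (.inr a) * c (.inl b) * (d (.inl a) * d (.inr b)) +
        ∑ a, c (.inr a) * d (.inr a) := by
    have hterm (a b : ι) : c (.inr a) * d (.inl a) * (c (.inl b) * d (.inr b)) =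
        c (.inr a) * c (.inl b) * (d (.inl a) * d (.inr b)) +
          if a = b then c (.inr a) * d (.inr b) else 0 := by
      rw [mul_assoc, ← mul_assoc (d _), h.d_mul_c]
      split_ifs <;> simp_all [mul_assoc, add_mul, mul_add]
    simp only [Finset.sum_mul_sum, hterm, Finset.sum_add_distrib, Finset.sum_ite_eq,
      Finset.mem_univ, if_true]
  have hnum' : ∑ a, ∑ b, c (.inl a) * c (.inr b) * (d (.inl a) * d (.inr b)) =
      ∑ a, ∑ b, c (.inr a) * c (.inl b) * (d (.inr a) * d (.inl b)) := by
    rw [Finset.sum_comm]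
    simp only [h.c_mul_c (.inl _) (.inr _), h.d_mul_d (.inl _) (.inr _)]
  have hhop' : ∑ a, ∑ b, c (.inl a) * c (.inr b) * (d (.inr a) * d (.inl b)) =
      ∑ a, ∑ b, c (.inr a) * c (.inl b) * (d (.inl a) * d (.inr b)) := by
    rw [Finset.sum_comm]
    simp only [h.c_mul_c (.inl _) (.inr _), h.d_mul_d (.inl _) (.inr _)]
  simp only [singletPair, sub_mul, mul_sub, Finset.sum_sub_distrib, hnum, hhop, hnum', hhop']
  noncomm_ring

/-! ### Creation and annihilation operators on the Fock space -/

section Fock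

variable {n : ℕ}

lemma ofReal_sqrt_mul_self (k : ℕ) : (Real.sqrt k : ℂ) * Real.sqrt k = k := by
  rw [← Complex.ofReal_mul, Real.mul_self_sqrt (Nat.cast_nonneg k), Complex.ofReal_natCast]

lemma ket_apply (μ ν : Occ n) : ket μ ν = if μ = ν then 1 else 0 := by
  classical
  exact Finsupp.single_apply

lemma smul_ket (μ : Occ n) (z : ℂ) : z • ket μ = Finsupp.single μ z := by
  simp [ket]

lemma single_one_le_iff {μ : Occ n} {i : Fin n ⊕ Fin n} : Finsupp.single i 1 ≤ μ ↔ μ i ≠ 0 := by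
  rw [Finsupp.single_le_iff, Nat.one_le_iff_ne_zero]

@[elab_as_elim]
lemma fock_induction_ket {p : Fock n → Prop} (v : Fock n) (zero : p 0)
    (add : ∀ v w, p v → p w → p (v + w)) (ket : ∀ μ (z : ℂ), p (z • ket μ)) : p v :=
  v.induction_linear zero add fun μ z => smul_ket μ z ▸ ket μ z

lemma raise_ket (i : Fin n ⊕ Fin n) (μ : Occ n) :
    raise i (ket μ) = (Real.sqrt (μ i + 1) : ℂ) • ket (μ + Finsupp.single i 1) := by
  simp [raise, ket]

lemma lower_ket (i : Fin n ⊕ Fin n) (μ : Occ n) :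
    lower i (ket μ) = (Real.sqrt (μ i) : ℂ) • ket (μ - Finsupp.single i 1) := by
  simp [lower, ket]

lemma lower_vacuum (i : Fin n ⊕ Fin n) : lower i (vacuum n) = 0 := by
  simp [vacuum, lower_ket]

lemma raise_apply (i : Fin n ⊕ Fin n) (v : Fock n) (μ : Occ n) :
    raise i v μ = (Real.sqrt (μ i) : ℂ) * v (μ - Finsupp.single i 1) := by
  induction v using fock_induction_ket with
  | zero => simp
  | add v w hv hw => simp [hv, hw, mul_add]
  | ket ν z =>
    simp only [map_smul, raise_ket, Finsupp.smul_apply, ket_apply, smul_eq_mul]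
    by_cases h : μ i = 0
    · have hne : ν + Finsupp.single i 1 ≠ μ := by rintro rfl; simp at h
      simp [h, hne]
    · simp only [eq_tsub_iff_add_eq_of_le (single_one_le_iff.2 h)]
      split_ifs with hν
      · simp [← hν, mul_comm]
      · simp

lemma lower_apply (i : Fin n ⊕ Fin n) (v : Fock n) (μ : Occ n) :
    lower i v μ = (Real.sqrt (μ i + 1) : ℂ) * v (μ + Finsupp.single i 1) := by
  induction v using fock_induction_ket with
  | zero => simp
  | add v w hv hw => simp [hv, hw, mul_add]
  | ket ν z =>
    simp only [map_smul, lower_ket, Finsupp.smul_apply, ket_apply, smul_eq_mul]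
    by_cases h : ν i = 0
    · have hne : ν ≠ μ + Finsupp.single i 1 := by rintro rfl; simp at h
      simp [h, hne]
    · simp only [tsub_eq_iff_eq_add_of_le (single_one_le_iff.2 h)]
      split_ifs with hν
      · simp [hν, mul_comm]
      · simp

lemma raise_lower_apply (i : Fin n ⊕ Fin n) (v : Fock n) (μ : Occ n) :
    raise i (lower i v) μ = μ i * v μ := by
  rw [raise_apply, lower_apply]
  by_cases h : μ i = 0
  · simp [h]
  · have hle := single_one_le_iff.2 h
    have hsucc : (((μ - Finsupp.single i 1 : Occ n) i : ℕ) : ℝ) + 1 = μ i := by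
      have := DFunLike.congr_fun (tsub_add_cancel_of_le hle) i
      rw [Finsupp.add_apply, Finsupp.single_eq_same] at this
      exact_mod_cast this
    rw [tsub_add_cancel_of_le hle, hsucc, ← mul_assoc, ofReal_sqrt_mul_self]

lemma lower_raise_apply (i : Fin n ⊕ Fin n) (v : Fock n) (μ : Occ n) :
    lower i (raise i v) μ = (μ i + 1) * v μ := by
  have hsqrt := ofReal_sqrt_mul_self (μ i + 1)
  push_cast at hsqrt
  simp [lower_apply, raise_apply, ← mul_assoc, hsqrt]

lemma lower_raise_of_ne {i j : Fin n ⊕ Fin n} (hij : i ≠ j) (v : Fock n) :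
    lower i (raise j v) = raise j (lower i v) := by
  ext μ
  simp only [lower_apply, raise_apply, Finsupp.add_apply, Finsupp.tsub_apply,
    Finsupp.single_eq_of_ne hij, Finsupp.single_eq_of_ne hij.symm, add_zero, tsub_zero]
  by_cases h : μ j = 0
  · simp [h]
  · rw [tsub_add_eq_add_tsub (single_one_le_iff.2 h)]
    ring

lemma raise_comm (i j : Fin n ⊕ Fin n) (v : Fock n) :
    raise i (raise j v) = raise j (raise i v) := by
  rcases eq_or_ne i j with rfl | h
  · rfl
  ext μ
  simp only [raise_apply, Finsupp.tsub_apply, Finsupp.single_eq_of_ne h,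
    Finsupp.single_eq_of_ne h.symm, tsub_zero, tsub_right_comm (b := Finsupp.single i 1)]
  ring

lemma lower_comm (i j : Fin n ⊕ Fin n) (v : Fock n) :
    lower i (lower j v) = lower j (lower i v) := by
  rcases eq_or_ne i j with rfl | h
  · rfl
  ext μ
  simp only [lower_apply, Finsupp.add_apply, Finsupp.single_eq_of_ne h,
    Finsupp.single_eq_of_ne h.symm, add_zero, add_right_comm _ (Finsupp.single i 1)]
  ring

lemma ccr : CCR (raise (n := n)) lower where
  lie_d_c i j := LinearMap.ext fun v => by
    rcases eq_or_ne i j with rfl | h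
    · ext μ
      simp [Ring.lie_def, raise_lower_apply, lower_raise_apply, add_mul]
    · simp [Ring.lie_def, lower_raise_of_ne h, h]
  lie_c_c i j := LinearMap.ext fun v => by simp [Ring.lie_def, raise_comm i j]
  lie_d_d i j := LinearMap.ext fun v => by simp [Ring.lie_def, lower_comm i j]

lemma sum_raise_mul_lower_apply {κ : Type*} [Fintype κ] (f : κ → Fin n ⊕ Fin n) (v : Fock n)
    (μ : Occ n) : (∑ k, raise (f k) * lower (f k)) v μ = (∑ k, μ (f k) : ℕ) * v μ := by
  simp only [LinearMap.sum_apply, Finsupp.finsetSum_apply, Module.End.mul_apply,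
    raise_lower_apply, Nat.cast_sum, Finset.sum_mul]

/-! ### The inner product -/

lemma fockInner_apply (v w : Fock n) : fockInner n v w = v.sum fun μ z => conj z * w μ := rfl

lemma fockInner_ket_left (μ : Occ n) (w : Fock n) : fockInner n (ket μ) w = w μ := by
  simp [fockInner_apply, ket]

lemma conj_fockInner (v w : Fock n) : conj (fockInner n v w) = fockInner n w v := by
  classical
  rw [fockInner_apply, fockInner_apply,
    Finsupp.sum_of_support_subset v (Finset.subset_union_left (s₂ := w.support)) _ (by simp),
    Finsupp.sum_of_support_subset w (Finset.subset_union_right (s₁ := v.support)) _ (by simp)]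
  simp [mul_comm]

lemma fockInner_self (v : Fock n) :
    fockInner n v v = ((∑ μ ∈ v.support, ‖v μ‖ ^ 2 : ℝ) : ℂ) := by
  rw [fockInner_apply, Finsupp.sum]
  push_cast
  exact Finset.sum_congr rfl fun μ _ => Complex.conj_mul' _

lemma fockInner_self_re_pos {v : Fock n} (hv : v ≠ 0) : 0 < (fockInner n v v).re := by
  rw [fockInner_self, Complex.ofReal_re]
  refine Finset.sum_pos (fun μ hμ => ?_) (Finsupp.support_nonempty_iff.2 hv)
  have : v μ ≠ 0 := Finsupp.mem_support_iff.1 hμ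
  positivity

lemma fockInner_self_re_nonneg (v : Fock n) : 0 ≤ (fockInner n v v).re := by
  rw [fockInner_self, Complex.ofReal_re]
  positivity

lemma fockInner_raise_left (i : Fin n ⊕ Fin n) (v w : Fock n) :
    fockInner n (raise i v) w = fockInner n v (lower i w) := by
  induction v using fock_induction_ket with
  | zero => simp
  | add v v' hv hv' => simp [hv, hv']
  | ket μ z =>
    rw [map_smul, map_smulₛₗ, map_smulₛₗ, raise_ket, map_smulₛₗ]
    simp [fockInner_ket_left, lower_apply]

lemma fockInner_lower_left (i : Fin n ⊕ Fin n) (v w : Fock n) :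
    fockInner n (lower i v) w = fockInner n v (raise i w) := by
  rw [← conj_fockInner, ← fockInner_raise_left, conj_fockInner]

lemma fockInner_vacuum_vacuum : fockInner n (vacuum n) (vacuum n) = 1 := by
  rw [vacuum, fockInner_ket_left, ket_apply, if_pos rfl]

lemma vacuum_ne_zero : vacuum n ≠ 0 :=
  Finsupp.single_ne_zero.2 one_ne_zero

end Fock

/-! ### Scalar operators and adjoints -/

section ScalarOperators

variable {n : ℕ}

lemma relations_opE_opF_opFt :
    Relations (n := n) (L := Module.End ℂ (Fock n)) opE opF opFt :=
  ccr.relations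

lemma opJz_eq_quad : opJz n = quad raise lower (sl2Matrix (Fin n) (1 / 2 : ℂ) 0 0) := by
  simp only [quad_sl2Matrix, zero_smul, add_zero]
  rfl

lemma opJp_eq_quad : opJp n = quad raise lower (sl2Matrix (Fin n) (0 : ℂ) 1 0) := by
  simp only [quad_sl2Matrix, zero_smul, one_smul, Finset.sum_const_zero, zero_add, add_zero]
  rfl

lemma opJm_eq_quad : opJm n = quad raise lower (sl2Matrix (Fin n) (0 : ℂ) 0 1) := by
  simp only [quad_sl2Matrix, zero_smul, one_smul, Finset.sum_const_zero, zero_add]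
  rfl

lemma isScalarOp_of_commute_quad {T : Module.End ℂ (Fock n)}
    (h : ∀ p q r : ℂ, Commute (quad raise lower (sl2Matrix (Fin n) p q r)) T) : IsScalarOp T :=
  ⟨opJz_eq_quad (n := n) ▸ h _ _ _, opJp_eq_quad (n := n) ▸ h _ _ _,
    opJm_eq_quad (n := n) ▸ h _ _ _⟩

lemma isScalarOp_opE (a b : Fin n) : IsScalarOp (opE a b) :=
  isScalarOp_of_commute_quad fun p q r => ccr.commute_sl2_unitaryGen p q r a b

lemma isScalarOp_opF (a b : Fin n) : IsScalarOp (opF a b) :=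
  isScalarOp_of_commute_quad fun p q r => ccr.commute_sl2_singletPair_d p q r a b

lemma isScalarOp_opFt (a b : Fin n) : IsScalarOp (opFt a b) :=
  isScalarOp_of_commute_quad fun p q r => ccr.commute_sl2_singletPair_c p q r a b

lemma fockInner_opE_left (a b : Fin n) (v w : Fock n) :
    fockInner n (opE a b v) w = fockInner n v (opE b a w) := by
  simp only [opE, opA, opB, opAd, opBd, LinearMap.add_apply, Module.End.mul_apply, map_add,
    fockInner_raise_left, fockInner_lower_left, eq_comm (a := a)]
  split_ifs <;> simp

lemma fockInner_opF_left (a b : Fin n) (v w : Fock n) :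
    fockInner n (opF a b v) w = fockInner n v (opFt a b w) := by
  simp only [opF, opFt, opA, opB, opAd, opBd, LinearMap.sub_apply, Module.End.mul_apply, map_sub,
    fockInner_lower_left, raise_comm (.inl b), raise_comm (.inr b)]

lemma fockInner_opFt_left (a b : Fin n) (v w : Fock n) :
    fockInner n (opFt a b v) w = fockInner n v (opF a b w) := by
  rw [← conj_fockInner, ← fockInner_opF_left, conj_fockInner]

/-! ### The number of quanta -/

/-- The operator counting the quanta of all the oscillators, whose eigenvalue `2J` singles out the
intertwiners of total area `J`. -/
def opN (n : ℕ) : Module.End ℂ (Fock n) := quad raise lower (1 : Mat2 n)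

lemma opN_apply (v : Fock n) (μ : Occ n) : opN n v μ = (∑ i, μ i : ℕ) * v μ := by
  rw [opN, quad_one, sum_raise_mul_lower_apply]

lemma lie_opN_opE (a b : Fin n) : ⁅opN n, opE a b⁆ = 0 :=
  ccr.lie_quad_one_unitaryGen a b

lemma lie_opN_opF (a b : Fin n) : ⁅opN n, opF a b⁆ = (-2 : ℂ) • opF a b :=
  ccr.lie_quad_one_singletPair_d a b

lemma lie_opN_opFt (a b : Fin n) : ⁅opN n, opFt a b⁆ = (2 : ℂ) • opFt a b :=
  ccr.lie_quad_one_singletPair_c a b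

lemma opN_eq_smul_iff {d : ℕ} {v : Fock n} :
    opN n v = (d : ℂ) • v ↔ ∀ μ, v μ ≠ 0 → ∑ i, μ i = d := by
  simp only [Finsupp.ext_iff, opN_apply, Finsupp.smul_apply, smul_eq_mul, mul_eq_mul_right_iff,
    Nat.cast_inj, or_iff_not_imp_right, ne_eq]

end ScalarOperators

/-! ### The spaces of intertwiners -/

section Intertwiners

variable {n : ℕ}

lemma mem_invariants_iff {v : Fock n} :
    v ∈ invariants n ↔ opJz n v = 0 ∧ opJp n v = 0 ∧ opJm n v = 0 := by
  simp only [invariants, Submodule.mem_inf, LinearMap.mem_ker, and_assoc]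

lemma IsScalarOp.apply_mem_invariants {T : Module.End ℂ (Fock n)} (hT : IsScalarOp T) {v : Fock n}
    (hv : v ∈ invariants n) : T v ∈ invariants n := by
  obtain ⟨hz, hp, hm⟩ := hT
  obtain ⟨vz, vp, vm⟩ := mem_invariants_iff.1 hv
  refine mem_invariants_iff.2 ⟨?_, ?_, ?_⟩
  · rw [← Module.End.mul_apply, hz.eq, Module.End.mul_apply, vz, map_zero]
  · rw [← Module.End.mul_apply, hp.eq, Module.End.mul_apply, vp, map_zero]
  · rw [← Module.End.mul_apply, hm.eq, Module.End.mul_apply, vm, map_zero]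

lemma opJz_apply (v : Fock n) (μ : Occ n) :
    opJz n v μ = (1 / 2 : ℂ) * ((∑ a, μ (.inl a) : ℕ) - (∑ a, μ (.inr a) : ℕ)) * v μ := by
  simp only [opJz, opAd, opA, opBd, opB, LinearMap.sum_apply, LinearMap.smul_apply,
    LinearMap.sub_apply, Module.End.mul_apply, Finsupp.finsetSum_apply, Finsupp.smul_apply,
    Finsupp.sub_apply, raise_lower_apply, smul_eq_mul, ← sub_mul, Nat.cast_sum,
    ← Finset.mul_sum, ← Finset.sum_mul, Finset.sum_sub_distrib, mul_assoc]

lemma sum_inl_eq_sum_inr {v : Fock n} (hv : v ∈ invariants n) {μ : Occ n} (hμ : v μ ≠ 0) :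
    ∑ a, μ (.inl a) = ∑ a, μ (.inr a) := by
  have h := congr($((mem_invariants_iff.1 hv).1) μ)
  rw [opJz_apply, Finsupp.zero_apply] at h
  simpa [hμ, sub_eq_zero, -Nat.cast_sum] using h

/-- The number of quanta on each leg. -/
def legs : Occ n →+ Fin n → ℕ where
  toFun μ a := μ (.inl a) + μ (.inr a)
  map_zero' := rfl
  map_add' _ _ := funext fun _ => add_add_add_comm _ _ _ _

lemma legs_apply (μ : Occ n) (a : Fin n) : legs μ a = μ (.inl a) + μ (.inr a) := rfl

lemma legs_single (i : Fin n ⊕ Fin n) (m : ℕ) :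
    legs (Finsupp.single i m) = Pi.single (Sum.elim id id i) m := by
  ext a
  rcases i with b | b <;> simp [legs_apply, Finsupp.single_apply, Pi.single_apply, eq_comm]

lemma sum_legs (μ : Occ n) : ∑ a, legs μ a = ∑ i, μ i := by
  simp [legs_apply, Finset.sum_add_distrib]

/-- The projection of the Fock space onto `legSpace k` along the other spaces of this form. -/
def legProj (k : Fin n → ℕ) : Module.End ℂ (Fock n) :=
  Submodule.subtype _ ∘ₗ Finsupp.restrictDom ℂ ℂ {μ : Occ n | legs μ = k}

lemma legProj_apply (k : Fin n → ℕ) (v : Fock n) (μ : Occ n) :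
    legProj k v μ = if legs μ = k then v μ else 0 := rfl

lemma legSpace_eq_supported (k : Fin n → ℕ) :
    legSpace k = Finsupp.supported ℂ ℂ {μ : Occ n | legs μ = k} := by
  rw [Finsupp.supported_eq_span_single, legSpace]
  congr 1
  ext v
  simp [ket, funext_iff, legs_apply, eq_comm]

lemma commute_raise_mul_lower_legProj {i j : Fin n ⊕ Fin n}
    (hij : Sum.elim id id i = Sum.elim id id j) (k : Fin n → ℕ) :
    Commute (raise i * lower j) (legProj k) := by
  refine LinearMap.ext fun v => Finsupp.ext fun μ => ?_
  simp only [Module.End.mul_apply, legProj_apply, raise_apply, lower_apply]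
  by_cases hi : μ i = 0
  · simp [hi]
  · obtain ⟨ν, rfl⟩ := exists_add_of_le (single_one_le_iff.2 hi)
    simp only [add_tsub_cancel_left, map_add, legs_single, hij, add_comm (Pi.single _ _)]
    split_ifs <;> simp

lemma isScalarOp_legProj (k : Fin n → ℕ) : IsScalarOp (legProj k) :=
  isScalarOp_of_commute_quad fun _ _ _ => commute_quad_sl2Matrix fun _ _ hij =>
    commute_raise_mul_lower_legProj hij k

lemma legProj_mem_invLeg (k : Fin n → ℕ) {v : Fock n} (hv : v ∈ invariants n) :
    legProj k v ∈ invLeg k := by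
  refine ⟨?_, (isScalarOp_legProj k).apply_mem_invariants hv⟩
  rw [legSpace_eq_supported]
  exact Submodule.coe_mem _

lemma sum_legProj (v : Fock n) : ∑ k ∈ v.support.image legs, legProj k v = v := by
  classical
  ext μ
  simp only [Finsupp.finsetSum_apply, legProj_apply, Finset.sum_ite_eq, ite_eq_left_iff,
    Finset.mem_image, not_exists, not_and]
  exact fun h => of_not_not fun h0 => h μ (Finsupp.mem_support_iff.2 (Ne.symm h0)) rfl

lemma mem_of_forall_invLeg_le {v : Fock n} (hv : v ∈ invariants n) {W : Submodule ℂ (Fock n)}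
    (h : ∀ μ, v μ ≠ 0 → invLeg (legs μ) ≤ W) : v ∈ W := by
  rw [← sum_legProj v]
  refine Submodule.sum_mem _ fun k hk => ?_
  obtain ⟨μ, hμ, rfl⟩ := Finset.mem_image.1 hk
  exact h μ (Finsupp.mem_support_iff.1 hμ) (legProj_mem_invLeg _ hv)

lemma invLeg_le_areaSpace {k : Fin n → ℕ} {J : ℕ} (hk : ∑ a, k a = 2 * J) :
    invLeg k ≤ areaSpace n J :=
  le_iSup (fun k : {k : Fin n → ℕ // ∑ a, k a = 2 * J} => invLeg k.1) ⟨k, hk⟩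

lemma mem_areaSpace_iff {J : ℕ} {v : Fock n} :
    v ∈ areaSpace n J ↔ v ∈ invariants n ∧ ∀ μ, v μ ≠ 0 → ∑ i, μ i = 2 * J := by
  constructor
  · suffices areaSpace n J ≤
        invariants n ⊓ Finsupp.supported ℂ ℂ {μ : Occ n | ∑ i, μ i = 2 * J} by
      intro hv
      exact ⟨(this hv).1, fun μ hμ => (this hv).2 (Finsupp.mem_support_iff.2 hμ)⟩
    refine iSup_le fun ⟨k, hk⟩ => le_inf inf_le_right (inf_le_left.trans ?_)
    rw [legSpace_eq_supported]
    refine Finsupp.supported_mono ?_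
    rintro μ rfl
    exact (sum_legs μ).symm.trans hk
  · rintro ⟨hv, h⟩
    exact mem_of_forall_invLeg_le hv fun μ hμ => invLeg_le_areaSpace ((sum_legs μ).trans (h μ hμ))

lemma mem_areaSpace_iff_opN {J : ℕ} {v : Fock n} :
    v ∈ areaSpace n J ↔ v ∈ invariants n ∧ opN n v = (2 * J : ℂ) • v := by
  rw [mem_areaSpace_iff, ← opN_eq_smul_iff]
  norm_cast

lemma intertwinerSpace_eq_invariants : intertwinerSpace n = invariants n := by
  refine le_antisymm (iSup_le fun J v hv => (mem_areaSpace_iff.1 hv).1) fun v hv =>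
    mem_of_forall_invLeg_le hv fun μ hμ => ?_
  refine (invLeg_le_areaSpace (J := ∑ a, μ (.inl a)) ?_).trans (le_iSup (areaSpace n) _)
  rw [sum_legs, Fintype.sum_sum_type, ← sum_inl_eq_sum_inr hv hμ, two_mul]

lemma sum_inl_eq_of_mem_areaSpace {J : ℕ} {v : Fock n} (hv : v ∈ areaSpace n J) {μ : Occ n}
    (hμ : v μ ≠ 0) : ∑ a, μ (.inl a) = J := by
  obtain ⟨hinv, hdeg⟩ := mem_areaSpace_iff.1 hv
  have htotal := hdeg μ hμ
  rw [Fintype.sum_sum_type, ← sum_inl_eq_sum_inr hinv hμ] at htotal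
  lia

lemma IsScalarOp.apply_mem_areaSpace {T : Module.End ℂ (Fock n)} (hT : IsScalarOp T) {J J' : ℕ}
    (hN : ⁅opN n, T⁆ = (2 * J' - 2 * J : ℂ) • T) {v : Fock n} (hv : v ∈ areaSpace n J) :
    T v ∈ areaSpace n J' := by
  rw [mem_areaSpace_iff_opN] at hv ⊢
  refine ⟨hT.apply_mem_invariants hv.1, ?_⟩
  have hTv : opN n (T v) - T (opN n v) = (2 * J' - 2 * J : ℂ) • T v := congr($hN v)
  rw [hv.2, map_smul, sub_eq_iff_eq_add] at hTv
  rw [hTv]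
  module

lemma opE_mem_areaSpace {J : ℕ} (a b : Fin n) {v : Fock n} (hv : v ∈ areaSpace n J) :
    opE a b v ∈ areaSpace n J :=
  (isScalarOp_opE a b).apply_mem_areaSpace (by rw [lie_opN_opE, sub_self, zero_smul]) hv

lemma opF_mem_areaSpace {J : ℕ} (a b : Fin n) {v : Fock n} (hv : v ∈ areaSpace n (J + 1)) :
    opF a b v ∈ areaSpace n J :=
  (isScalarOp_opF a b).apply_mem_areaSpace
    (by rw [lie_opN_opF]; congr 1; push_cast; ring) hv

lemma opFt_mem_areaSpace {J : ℕ} (a b : Fin n) {v : Fock n} (hv : v ∈ areaSpace n J) :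
    opFt a b v ∈ areaSpace n (J + 1) :=
  (isScalarOp_opFt a b).apply_mem_areaSpace
    (by rw [lie_opN_opFt]; congr 1; push_cast; ring) hv

/-- On the invariants the Capelli identity loses its term `J_- J_+`. -/
lemma sum_opFt_opF_apply {v : Fock n} (hv : v ∈ invariants n) (μ : Occ n) :
    (∑ a, ∑ b, opFt a b (opF a b v)) μ =
      2 * ((∑ a, μ (.inl a) : ℕ) * ((∑ a, μ (.inl a) : ℕ) + 1)) * v μ := by
  have hp : opJp n v = 0 := (mem_invariants_iff.1 hv).2.1
  have hA (w : Fock n) : (∑ a, opAd a * opA a) w μ = (∑ a, μ (.inl a) : ℕ) * w μ :=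
    sum_raise_mul_lower_apply Sum.inl w μ
  have hB (w : Fock n) : (∑ a, opBd a * opB a) w μ = (∑ a, μ (.inr a) : ℕ) * w μ :=
    sum_raise_mul_lower_apply Sum.inr w μ
  have hAB : ((∑ a, μ (.inr a) : ℕ) : ℂ) * v μ = (∑ a, μ (.inl a) : ℕ) * v μ :=
    mul_eq_mul_right_iff.2 <| (eq_or_ne (v μ) 0).symm.imp_left fun hμ => by
      rw [sum_inl_eq_sum_inr hv hμ]
  calc (∑ a, ∑ b, opFt a b (opF a b v)) μ
    _ = (∑ a, ∑ b, opFt a b * opF a b) v μ := by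
      simp only [LinearMap.sum_apply, Module.End.mul_apply]
    _ = (2 * ((∑ a, opBd a * opB a) * (∑ a, opAd a * opA a) - opJm n * opJp n +
          ∑ a, opBd a * opB a) : Module.End ℂ (Fock n)) v μ :=
      congr($((ccr (n := n)).sum_singletPair_mul_singletPair) v μ)
    _ = 2 * ((∑ a, μ (.inr a) : ℕ) * ((∑ a, μ (.inl a) : ℕ) * v μ) +
          (∑ a, μ (.inr a) : ℕ) * v μ) := by
      rw [two_mul]
      simp only [LinearMap.add_apply, LinearMap.sub_apply, Module.End.mul_apply, hp, map_zero,
        Finsupp.add_apply, Finsupp.sub_apply, Finsupp.zero_apply, hA, hB]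
      ring
    _ = 2 * ((∑ a, μ (.inl a) : ℕ) * ((∑ a, μ (.inl a) : ℕ) + 1)) * v μ := by
      linear_combination 2 * (((∑ a, μ (.inl a) : ℕ) : ℂ) + 1) * hAB

lemma sum_opFt_opF {J : ℕ} {v : Fock n} (hv : v ∈ areaSpace n J) :
    ∑ a, ∑ b, opFt a b (opF a b v) = (2 * (J * (J + 1)) : ℂ) • v := by
  ext μ
  rw [sum_opFt_opF_apply (mem_areaSpace_iff.1 hv).1, Finsupp.smul_apply, smul_eq_mul]
  exact mul_eq_mul_right_iff.2 <| (eq_or_ne (v μ) 0).symm.imp_left fun hμ => by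
    rw [sum_inl_eq_of_mem_areaSpace hv hμ]

lemma vacuum_mem_areaSpace : vacuum n ∈ areaSpace n 0 := by
  rw [mem_areaSpace_iff_opN, mem_invariants_iff]
  simp [opJz, opJp, opJm, opN, quad_one, LinearMap.sum_apply, opA, opB, lower_vacuum]

lemma exists_eq_smul_vacuum {v : Fock n} (hv : v ∈ areaSpace n 0) : ∃ z : ℂ, v = z • vacuum n := by
  refine ⟨v 0, Finsupp.ext fun μ => ?_⟩
  rw [vacuum, Finsupp.smul_apply, ket_apply, smul_eq_mul, mul_ite, mul_one, mul_zero]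
  split_ifs with h0
  · rw [h0]
  · refine of_not_not fun hμ => h0 (Finsupp.ext fun i => ?_)
    have hdeg : ∑ i, μ i = 0 := (mem_areaSpace_iff.1 hv).2 μ hμ
    exact (Finset.sum_eq_zero_iff.1 hdeg i (Finset.mem_univ i)).symm

lemma exists_eq_smul_vacuum_of_forall_opF_eq_zero {v : Fock n} (hv : v ∈ invariants n)
    (h : ∀ a b, opF a b v = 0) : ∃ z : ℂ, v = z • vacuum n := by
  refine exists_eq_smul_vacuum (mem_areaSpace_iff.2 ⟨hv, fun μ hμ => ?_⟩)
  have hcap := sum_opFt_opF_apply hv μ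
  simp only [h, map_zero, Finset.sum_const_zero, Finsupp.zero_apply] at hcap
  have hA : ∑ a, μ (.inl a) = 0 := by
    have hsucc := Nat.cast_add_one_ne_zero (R := ℂ) (∑ a, μ (.inl a))
    simpa [hμ, hsucc, -Nat.cast_sum] using hcap.symm
  rw [Fintype.sum_sum_type, ← sum_inl_eq_sum_inr hv hμ, hA]

end Intertwiners

/-! ### Descent along the number of quanta -/

section Descent

lemma exists_ne_zero_forall_eq_zero_of_filtration {R M ι : Type*} [Semiring R] [AddCommMonoid M]
    [Module R M] {Φ : ℕ → Submodule R M} (hzero : Φ 0 = ⊥) (hexhaust : ∀ v, ∃ m, v ∈ Φ m)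
    {T : ι → Module.End R M} (hT : ∀ i m, ∀ v ∈ Φ (m + 1), T i v ∈ Φ m) {W : Submodule R M}
    (hW : ∀ i, ∀ v ∈ W, T i v ∈ W) (hne : W ≠ ⊥) : ∃ v ∈ W, v ≠ 0 ∧ ∀ i, T i v = 0 := by
  obtain ⟨v, hv, hv0⟩ := W.exists_mem_ne_zero_of_ne_bot hne
  obtain ⟨m, hm⟩ := hexhaust v
  induction m generalizing v with
  | zero => exact absurd ((Submodule.mem_bot R).1 (hzero ▸ hm)) hv0
  | succ m ih =>
    by_cases hkill : ∀ i, T i v = 0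
    · exact ⟨v, hv, hv0, hkill⟩
    · obtain ⟨i, hi⟩ := not_forall.1 hkill
      exact ih (T i v) (hW i v hv) hi (hT i m v hm)

variable {n : ℕ} {w : Fin n ⊕ Fin n → ℕ}

/-- The span of the `|μ⟩` of weight `∑ w_i μ_i` less than `m`. -/
def weightLT (w : Fin n ⊕ Fin n → ℕ) (m : ℕ) : Submodule ℂ (Fock n) :=
  Finsupp.supported ℂ ℂ {μ | Finsupp.weight w μ < m}

lemma mem_weightLT_iff {m : ℕ} {v : Fock n} :
    v ∈ weightLT w m ↔ ∀ μ, v μ ≠ 0 → Finsupp.weight w μ < m := by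
  simp only [weightLT, Finsupp.mem_supported, Set.subset_def, Finset.mem_coe,
    Finsupp.mem_support_iff, Set.mem_ofPred_eq]

lemma weightLT_zero : weightLT w 0 = ⊥ := by
  simp [weightLT]

lemma exists_mem_weightLT (w : Fin n ⊕ Fin n → ℕ) (v : Fock n) : ∃ m, v ∈ weightLT w m :=
  ⟨v.support.sup (Finsupp.weight w) + 1, mem_weightLT_iff.2 fun _ hμ =>
    Nat.lt_succ_of_le (Finset.le_sup (Finsupp.mem_support_iff.2 hμ))⟩

lemma weightLT_mono {m m' : ℕ} (h : m ≤ m') : weightLT w m ≤ weightLT w m' :=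
  Finsupp.supported_mono fun _ hμ => lt_of_lt_of_le hμ h

lemma weight_add_single (w : Fin n ⊕ Fin n → ℕ) (μ : Occ n) (i : Fin n ⊕ Fin n) :
    Finsupp.weight w (μ + Finsupp.single i 1) = Finsupp.weight w μ + w i := by
  rw [map_add, Finsupp.weight_single, one_smul]

lemma lower_mem_weightLT {m : ℕ} {v : Fock n} (hv : v ∈ weightLT w m) (i : Fin n ⊕ Fin n) :
    lower i v ∈ weightLT w (m - w i) := by
  refine mem_weightLT_iff.2 fun μ hμ => ?_
  rw [lower_apply] at hμ
  have hlt := mem_weightLT_iff.1 hv _ (right_ne_zero_of_mul hμ)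
  rw [weight_add_single] at hlt
  exact Nat.lt_sub_of_add_lt hlt

lemma raise_lower_mem_weightLT {m : ℕ} {v : Fock n} (hv : v ∈ weightLT w (m + 1))
    {i j : Fin n ⊕ Fin n} (hij : w i < w j) : raise i (lower j v) ∈ weightLT w m := by
  refine mem_weightLT_iff.2 fun μ hμ => ?_
  rw [raise_apply] at hμ
  have hi : μ i ≠ 0 := fun hi => hμ (by simp [hi])
  obtain ⟨ν, rfl⟩ := exists_add_of_le (single_one_le_iff.2 hi)
  rw [add_tsub_cancel_left, lower_apply] at hμ
  have hlt := mem_weightLT_iff.1 hv _ (right_ne_zero_of_mul (right_ne_zero_of_mul hμ))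
  rw [weight_add_single] at hlt
  rw [add_comm, weight_add_single]
  lia

end Descent

/-! ### Irreducibility of the space of all intertwiners -/

section Irreducibility

variable {n : ℕ} {W : Submodule ℂ (Fock n)}

lemma vacuum_mem_of_opF_stable (hW : W ≤ invariants n) (hF : ∀ a b, ∀ v ∈ W, opF a b v ∈ W)
    (hne : W ≠ ⊥) : vacuum n ∈ W := by
  obtain ⟨v, hv, hv0, hkill⟩ := exists_ne_zero_forall_eq_zero_of_filtration
    (Φ := weightLT 1) (T := fun p : Fin n × Fin n => opF p.1 p.2) weightLT_zero
    (exists_mem_weightLT 1)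
    (fun _ _ _ hv => weightLT_mono (Nat.sub_le _ 1)
      (Submodule.sub_mem _ (lower_mem_weightLT (lower_mem_weightLT hv _) _)
        (lower_mem_weightLT (lower_mem_weightLT hv _) _)))
    (fun p => hF p.1 p.2) hne
  obtain ⟨z, rfl⟩ := exists_eq_smul_vacuum_of_forall_opF_eq_zero (hW hv) fun a b => hkill (a, b)
  exact (W.smul_mem_iff (left_ne_zero_of_smul hv0)).1 hv

lemma areaSpace_le_of_opFt_stable (hFt : ∀ a b, ∀ v ∈ W, opFt a b v ∈ W) (h0 : vacuum n ∈ W)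
    (J : ℕ) : areaSpace n J ≤ W := by
  induction J with
  | zero =>
    intro v hv
    obtain ⟨z, rfl⟩ := exists_eq_smul_vacuum hv
    exact W.smul_mem z h0
  | succ J ih =>
    intro v hv
    have hJ : (2 * ((J + 1 : ℕ) * ((J + 1 : ℕ) + 1)) : ℂ) ≠ 0 := by norm_cast
    rw [← W.smul_mem_iff hJ, ← sum_opFt_opF hv]
    exact W.sum_mem fun a _ => W.sum_mem fun b _ => hFt a b _ (ih (opF_mem_areaSpace a b hv))

lemma intertwinerSpace_irreducible (hW : W ≤ intertwinerSpace n)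
    (hF : ∀ a b, ∀ v ∈ W, opF a b v ∈ W) (hFt : ∀ a b, ∀ v ∈ W, opFt a b v ∈ W) :
    W = ⊥ ∨ W = intertwinerSpace n :=
  or_iff_not_imp_left.2 fun hne => hW.antisymm <| iSup_le <| areaSpace_le_of_opFt_stable hFt <|
    vacuum_mem_of_opF_stable (hW.trans intertwinerSpace_eq_invariants.le) hF hne

end Irreducibility

/-! ### Highest weight vectors of fixed total area -/

section HighestWeight

variable {n : ℕ}

lemma opF_opFt_apply {p q : Fin n} (hpq : p ≠ q) (v : Fock n) :
    opF p q (opFt p q v) = opFt p q (opF p q v) + (opE p p v + opE q q v) := by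
  have h := (relations_opE_opF_opFt (n := n)).F_Ft p q p q
  rw [Ring.lie_def, sub_eq_iff_eq_add'] at h
  refine congr($h v).trans ?_
  simp [hpq, hpq.symm]

lemma opE_opFt_apply (a b p q : Fin n) (v : Fock n) :
    opE a b (opFt p q v) = opFt p q (opE a b v) +
      ((if b = p then opFt a q v else 0) - if b = q then opFt a p v else 0) := by
  have h := (relations_opE_opF_opFt (n := n)).E_Ft a b p q
  rw [Ring.lie_def, sub_eq_iff_eq_add'] at h
  refine congr($h v).trans ?_
  split_ifs <;> rfl

lemma opF_swap_apply (a b : Fin n) (v : Fock n) : opF b a v = -opF a b v :=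
  congr($((relations_opE_opF_opFt (n := n)).F_antisymm a b) v)

lemma opFt_swap_apply (a b : Fin n) (v : Fock n) : opFt b a v = -opFt a b v :=
  congr($((relations_opE_opF_opFt (n := n)).Ft_antisymm a b) v)

lemma opF_self_apply (a : Fin n) (v : Fock n) : opF a a v = 0 :=
  self_eq_neg.1 (opF_swap_apply a a v)

lemma opFt_self_apply (a : Fin n) (v : Fock n) : opFt a a v = 0 :=
  self_eq_neg.1 (opFt_swap_apply a a v)

lemma opE_vacuum (a b : Fin n) : opE a b (vacuum n) = if a = b then vacuum n else 0 := by
  simp only [opE, opA, opB, LinearMap.add_apply, Module.End.mul_apply, lower_vacuum, map_zero,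
    zero_add]
  split_ifs <;> rfl

lemma opF_vacuum (a b : Fin n) : opF a b (vacuum n) = 0 := by
  simp [opF, opA, opB, lower_vacuum]

lemma fockInner_self_re_le_opE (a : Fin n) (v : Fock n) :
    (fockInner n v v).re ≤ (fockInner n v (opE a a v)).re := by
  simp only [opE, opA, opB, opAd, opBd, LinearMap.add_apply, Module.End.mul_apply, map_add,
    ← fockInner_lower_left, if_true, Module.End.one_apply, Complex.add_re]
  have hA := fockInner_self_re_nonneg (lower (.inl a) v)
  have hB := fockInner_self_re_nonneg (lower (.inr a) v)
  linarith

/-- Since `F_pq` is adjoint to `F̃_pq` and `F_pq F̃_pq = F̃_pq F_pq + E_pp + E_qq`, the norm of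
`F̃_pq v` is at least that of `v`. -/
lemma opFt_injective {p q : Fin n} (hpq : p ≠ q) : Function.Injective (opFt p q) := by
  refine (injective_iff_map_eq_zero _).2 fun v hv => by_contra fun hv0 => ?_
  have hcomm := congr((fockInner n v $(opF_opFt_apply hpq v)).re)
  rw [hv, map_add, map_add, ← fockInner_opF_left] at hcomm
  simp only [map_zero, Complex.add_re, Complex.zero_re] at hcomm
  have hF := fockInner_self_re_nonneg (opF p q v)
  have hp := fockInner_self_re_le_opE p v
  have hq := fockInner_self_re_le_opE q v
  have hpos := fockInner_self_re_pos hv0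
  linarith

lemma opA_eq_zero_of_opE_eq_zero {p q b : Fin n} (hpq : p ≠ q) (hpb : p ≠ b) (hqb : q ≠ b)
    {v : Fock n} (hp : opE p b v = 0) (hq : opE q b v = 0) : opA b v = 0 := by
  refine opFt_injective hpq ((?_ : opFt p q (opA b v) = 0).trans (map_zero _).symm)
  refine congr($((ccr (n := n)).singletPair_mul_d_inl hpb hqb) v).trans ?_
  change opBd p (opE q b v) - opBd q (opE p b v) = 0
  rw [hp, hq, map_zero, map_zero, sub_zero]

lemma opB_eq_zero_of_opE_eq_zero {p q b : Fin n} (hpq : p ≠ q) (hpb : p ≠ b) (hqb : q ≠ b)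
    {v : Fock n} (hp : opE p b v = 0) (hq : opE q b v = 0) : opB b v = 0 := by
  refine opFt_injective hpq ((?_ : opFt p q (opB b v) = 0).trans (map_zero _).symm)
  refine congr($((ccr (n := n)).singletPair_mul_d_inr hpb hqb) v).trans ?_
  change opAd q (opE p b v) - opAd p (opE q b v) = 0
  rw [hp, hq, map_zero, map_zero, sub_zero]

lemma sum_opFt_opF_eq_two_smul {p q : Fin n} (hpq : p ≠ q) {v : Fock n}
    (hv : ∀ b, b ≠ p → b ≠ q → opA b v = 0 ∧ opB b v = 0) :
    ∑ a, ∑ b, opFt a b (opF a b v) = (2 : ℂ) • opFt p q (opF p q v) := by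
  have hright (a b : Fin n) (hb : b ≠ p ∧ b ≠ q) : opFt a b (opF a b v) = 0 := by
    obtain ⟨hA, hB⟩ := hv b hb.1 hb.2
    simp only [opF, LinearMap.sub_apply, Module.End.mul_apply, hA, hB, map_zero, sub_zero]
  have hleft (a b : Fin n) (ha : a ≠ p ∧ a ≠ q) : opFt a b (opF a b v) = 0 := by
    rw [opF_swap_apply, opFt_swap_apply, map_neg, neg_neg, hright b a ha]
  calc ∑ a, ∑ b, opFt a b (opF a b v)
    _ = opFt p q (opF p q v) + opFt q p (opF q p v) := by
      rw [Fintype.sum_eq_add p q hpq fun a ha => Finset.sum_eq_zero fun b _ => hleft a b ha,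
        Fintype.sum_eq_add p q hpq (hright p), Fintype.sum_eq_add p q hpq (hright q),
        opF_self_apply, opF_self_apply, map_zero, map_zero, zero_add, add_zero]
    _ = (2 : ℂ) • opFt p q (opF p q v) := by
      rw [opF_swap_apply, opFt_swap_apply, map_neg, neg_neg, two_smul]

lemma exists_eq_smul_opFt_pow {p q : Fin n} (hpq : p ≠ q) {J : ℕ} {v : Fock n}
    (hv : v ∈ areaSpace n J) (h : ∀ b, b ≠ p → b ≠ q → opA b v = 0 ∧ opB b v = 0) :
    ∃ z : ℂ, v = z • (opFt p q ^ J) (vacuum n) := by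
  induction J generalizing v with
  | zero => simpa using exists_eq_smul_vacuum hv
  | succ J ih =>
    have hcomm (i : Fin n ⊕ Fin n) (hi : lower i v = 0) : lower i (opF p q v) = 0 :=
      congr($(ccr.commute_d_singletPair_d i p q) v).trans
        (congr(opF p q $hi).trans (map_zero _))
    obtain ⟨z, hz⟩ := ih (opF_mem_areaSpace p q hv) fun b hbp hbq =>
      (h b hbp hbq).imp (hcomm _) (hcomm _)
    have hJ : (2 * ((J + 1 : ℕ) * ((J + 1 : ℕ) + 1)) : ℂ) ≠ 0 := by norm_cast
    refine ⟨(2 * ((J + 1 : ℕ) * ((J + 1 : ℕ) + 1)) : ℂ)⁻¹ * (2 * z), ?_⟩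
    rw [mul_smul, eq_inv_smul_iff₀ hJ, ← sum_opFt_opF hv, sum_opFt_opF_eq_two_smul hpq h, hz,
      map_smul, pow_succ', Module.End.mul_apply, smul_smul]

lemma opFt_pow_vacuum_mem_areaSpace (p q : Fin n) (J : ℕ) :
    (opFt p q ^ J) (vacuum n) ∈ areaSpace n J := by
  induction J with
  | zero => exact vacuum_mem_areaSpace
  | succ J ih =>
    rw [pow_succ', Module.End.mul_apply]
    exact opFt_mem_areaSpace p q ih

lemma opE_self_opFt_pow_vacuum {p q : Fin n} (hpq : p ≠ q) (J : ℕ) (a : Fin n) :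
    opE a a ((opFt p q ^ J) (vacuum n)) =
      (if a = p ∨ a = q then (J : ℂ) + 1 else 1) • (opFt p q ^ J) (vacuum n) := by
  induction J with
  | zero => simp [opE_vacuum]
  | succ J ih =>
    rw [pow_succ', Module.End.mul_apply, opE_opFt_apply, ih, map_smul]
    push_cast
    rcases eq_or_ne a p with rfl | hp
    · simp only [if_true, true_or, if_neg hpq]
      module
    rcases eq_or_ne a q with rfl | hq
    · simp only [if_true, or_true, if_neg hpq.symm, opFt_swap_apply p a]
      module
    · simp [hp, hq]

lemma opE_opFt_pow_vacuum_of_lt {p q : Fin n} (hp : (p : ℕ) = 0) (hq : (q : ℕ) = 1) (J : ℕ)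
    {a b : Fin n} (hab : a < b) : opE a b ((opFt p q ^ J) (vacuum n)) = 0 := by
  induction J with
  | zero => simp [opE_vacuum, hab.ne]
  | succ J ih =>
    rw [pow_succ', Module.End.mul_apply, opE_opFt_apply, ih, map_zero, zero_add,
      if_neg (by lia : b ≠ p), zero_sub, neg_eq_zero, ite_eq_right_iff]
    intro hbq
    rw [(by lia : a = p), opFt_self_apply]

lemma opF_opFt_pow_vacuum {p q : Fin n} (hpq : p ≠ q) (J : ℕ) :
    opF p q ((opFt p q ^ (J + 1)) (vacuum n)) =
      ((J + 1) * (J + 2) : ℂ) • (opFt p q ^ J) (vacuum n) := by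
  induction J with
  | zero =>
    simp only [pow_succ', pow_zero, mul_one, Module.End.one_apply, opF_opFt_apply hpq, opF_vacuum,
      opE_vacuum, map_zero, if_true, Nat.cast_zero]
    module
  | succ J ih =>
    rw [pow_succ', Module.End.mul_apply, opF_opFt_apply hpq, ih, map_smul,
      opE_self_opFt_pow_vacuum hpq, opE_self_opFt_pow_vacuum hpq, ← Module.End.mul_apply,
      ← pow_succ', if_pos (.inl rfl), if_pos (.inr rfl)]
    push_cast
    module

lemma fockInner_opFt_pow_vacuum {p q : Fin n} (hpq : p ≠ q) (J : ℕ) :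
    fockInner n ((opFt p q ^ J) (vacuum n)) ((opFt p q ^ J) (vacuum n)) =
      J.factorial * (J + 1).factorial := by
  induction J with
  | zero => simp [fockInner_vacuum_vacuum]
  | succ J ih =>
    nth_rw 1 [pow_succ']
    rw [Module.End.mul_apply, fockInner_opFt_left, opF_opFt_pow_vacuum hpq, map_smul, ih,
      smul_eq_mul, Nat.factorial_succ (J + 1), Nat.factorial_succ J]
    push_cast
    ring

lemma exists_highestWeight {W : Submodule ℂ (Fock n)} (hE : ∀ a b, ∀ v ∈ W, opE a b v ∈ W)
    (hne : W ≠ ⊥) : ∃ v ∈ W, v ≠ 0 ∧ ∀ a b, a < b → opE a b v = 0 := by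
  obtain ⟨v, hv, hv0, hkill⟩ := exists_ne_zero_forall_eq_zero_of_filtration
    (Φ := weightLT (Sum.elim Fin.val Fin.val))
    (T := fun p : {p : Fin n × Fin n // p.1 < p.2} => opE p.1.1 p.1.2) weightLT_zero
    (exists_mem_weightLT _)
    (fun p m v hv => by
      rw [opE, if_neg p.2.ne, add_zero]
      exact Submodule.add_mem _ (raise_lower_mem_weightLT hv p.2)
        (raise_lower_mem_weightLT hv p.2))
    (fun p => hE p.1.1 p.1.2) hne
  exact ⟨v, hv, hv0, fun a b hab => hkill ⟨(a, b), hab⟩⟩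

lemma exists_eq_smul_of_highestWeight {p q : Fin n} (hp : (p : ℕ) = 0) (hq : (q : ℕ) = 1) {J : ℕ}
    {v : Fock n} (hv : v ∈ areaSpace n J) (h : ∀ a b, a < b → opE a b v = 0) :
    ∃ z : ℂ, v = z • (opFt p q ^ J) (vacuum n) := by
  have hpq : p ≠ q := by lia
  refine exists_eq_smul_opFt_pow hpq hv fun b hbp hbq => ?_
  have hEp : opE p b v = 0 := h p b (by lia)
  have hEq : opE q b v = 0 := h q b (by lia)
  exact ⟨opA_eq_zero_of_opE_eq_zero hpq hbp.symm hbq.symm hEp hEq,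
    opB_eq_zero_of_opE_eq_zero hpq hbp.symm hbq.symm hEp hEq⟩

lemma opFt_pow_vacuum_mem_of_opE_stable {p q : Fin n} (hp : (p : ℕ) = 0) (hq : (q : ℕ) = 1)
    {J : ℕ} {W : Submodule ℂ (Fock n)} (hW : W ≤ areaSpace n J)
    (hE : ∀ a b, ∀ v ∈ W, opE a b v ∈ W) (hne : W ≠ ⊥) : (opFt p q ^ J) (vacuum n) ∈ W := by
  obtain ⟨v, hv, hv0, hkill⟩ := exists_highestWeight hE hne
  obtain ⟨z, rfl⟩ := exists_eq_smul_of_highestWeight hp hq (hW hv) hkill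
  exact (W.smul_mem_iff (left_ne_zero_of_smul hv0)).1 hv

end HighestWeight

/-! ### Irreducibility of the spaces of fixed total area -/

lemma sup_inf_orthogonalBilin {E : Type*} [AddCommGroup E] [Module ℂ E]
    {B : E →ₗ⋆[ℂ] E →ₗ[ℂ] ℂ} (hermitian : ∀ v w, conj (B v w) = B w v)
    (pos : ∀ v, v ≠ 0 → 0 < (B v v).re) {W H : Submodule ℂ E} [FiniteDimensional ℂ W]
    (hWH : W ≤ H) : W ⊔ H ⊓ W.orthogonalBilin B = H := by
  let core : InnerProductSpace.Core ℂ E :=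
    { inner := fun v w => B v w
      conj_inner_symm := fun v w => hermitian w v
      re_inner_nonneg := fun v => by
        rcases eq_or_ne v 0 with rfl | hv
        · simp
        · exact (pos v hv).le
      definite := fun v hv => by_contra fun hv0 => (pos v hv0).ne' (by rw [hv, Complex.zero_re])
      add_left := fun u v w => by rw [map_add, LinearMap.add_apply]
      smul_left := fun v w z => by rw [map_smulₛₗ, LinearMap.smul_apply, smul_eq_mul] }
  let : NormedAddCommGroup E := core.toNormedAddCommGroup
  let : InnerProductSpace ℂ E := .ofCore core.toCore
  have horth : Wᗮ = W.orthogonalBilin B := rfl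
  rw [← horth, inf_comm]
  exact Submodule.sup_orthogonal_inf_of_hasOrthogonalProjection hWH

section AreaSpace

variable {n : ℕ}

instance finiteDimensional_areaSpace (J : ℕ) : FiniteDimensional ℂ (areaSpace n J) := by
  have hfin : {μ : Occ n | ∑ i, μ i = 2 * J}.Finite :=
    (Finset.finsuppAntidiag Finset.univ (2 * J)).finite_toSet.subset fun μ hμ => by simpa using hμ
  have : FiniteDimensional ℂ (Finsupp.supported ℂ ℂ {μ : Occ n | ∑ i, μ i = 2 * J}) := by
    rw [Finsupp.supported_eq_span_single]
    exact FiniteDimensional.span_of_finite ℂ (hfin.image _)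
  refine Submodule.finiteDimensional_of_le (S₂ := Finsupp.supported ℂ ℂ
    {μ : Occ n | ∑ i, μ i = 2 * J}) fun v hv => ?_
  exact fun μ hμ => (mem_areaSpace_iff.1 hv).2 μ (Finsupp.mem_support_iff.1 hμ)

lemma areaSpace_irreducible (hn : 2 ≤ n) {J : ℕ} {W : Submodule ℂ (Fock n)}
    (hW : W ≤ areaSpace n J) (hE : ∀ a b, ∀ v ∈ W, opE a b v ∈ W) :
    W = ⊥ ∨ W = areaSpace n J := by
  have := Submodule.finiteDimensional_of_le hW
  set U := areaSpace n J ⊓ W.orthogonalBilin (fockInner n)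
  have hdecomp : W ⊔ U = areaSpace n J :=
    sup_inf_orthogonalBilin conj_fockInner (fun _ => fockInner_self_re_pos) hW
  have hUE (a b : Fin n) (v : Fock n) (hv : v ∈ U) : opE a b v ∈ U :=
    ⟨opE_mem_areaSpace a b hv.1, fun w hw =>
      (fockInner_opE_left b a w v).symm.trans (hv.2 _ (hE b a w hw))⟩
  refine or_iff_not_imp_left.2 fun hW0 => ?_
  suffices U = ⊥ by rw [← hdecomp, this, sup_bot_eq]
  by_contra hU0
  let p : Fin n := ⟨0, by lia⟩
  let q : Fin n := ⟨1, by lia⟩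
  have hpq : p ≠ q := by simp [p, q]
  have hmemW := opFt_pow_vacuum_mem_of_opE_stable (p := p) (q := q) rfl rfl hW hE hW0
  have horth := (opFt_pow_vacuum_mem_of_opE_stable (p := p) (q := q) rfl rfl inf_le_left hUE
    hU0).2 _ hmemW
  rw [fockInner_opFt_pow_vacuum hpq] at horth
  exact (mul_ne_zero (Nat.cast_ne_zero.2 J.factorial_ne_zero)
    (Nat.cast_ne_zero.2 (J + 1).factorial_ne_zero)) horth

end AreaSpace

/-! ### The vectors `ψ_J` -/

section Psi

variable {n : ℕ} (hn : 2 ≤ n) {J : ℕ}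

lemma psi_mem_areaSpace : psi hn J ∈ areaSpace n J :=
  Submodule.smul_mem _ _ (opFt_pow_vacuum_mem_areaSpace _ _ _)

lemma sqrt_factorial_mul_factorial_ne_zero (J : ℕ) :
    (Real.sqrt (J.factorial * (J + 1).factorial) : ℂ) ≠ 0 :=
  Complex.ofReal_ne_zero.2 (Real.sqrt_pos.2 (by positivity)).ne'

lemma fockInner_psi : fockInner n (psi hn J) (psi hn J) = 1 := by
  have hsqrt := ofReal_sqrt_mul_self (J.factorial * (J + 1).factorial)
  push_cast at hsqrt
  rw [psi, map_smul, map_smulₛₗ, LinearMap.smul_apply, fockInner_opFt_pow_vacuum (by simp),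
    ← hsqrt, map_inv₀, Complex.conj_ofReal, smul_eq_mul, smul_eq_mul,
    inv_mul_cancel_left₀ (sqrt_factorial_mul_factorial_ne_zero J),
    inv_mul_cancel₀ (sqrt_factorial_mul_factorial_ne_zero J)]

lemma isHighestWeight_psi :
    IsHighestWeight (fun a : Fin n => if (a : ℕ) < 2 then (J : ℂ) + 1 else 1) (psi hn J) := by
  refine ⟨fun h0 => ?_, fun a => ?_, fun a b hab => ?_⟩
  · have hnorm := fockInner_psi hn (J := J)
    rw [h0, map_zero] at hnorm
    exact zero_ne_one hnorm
  · have hiff : (a = ⟨0, by lia⟩ ∨ a = ⟨1, by lia⟩) ↔ (a : ℕ) < 2 := by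
      simp only [Fin.ext_iff]
      lia
    rw [psi, map_smul, opE_self_opFt_pow_vacuum (by simp), smul_comm]
    simp only [hiff]
  · rw [psi, map_smul, opE_opFt_pow_vacuum_of_lt rfl rfl _ hab, smul_zero]

lemma exists_eq_exp_smul_psi {w : Fock n} (hw : w ∈ areaSpace n J)
    (hE : ∀ a b, a < b → opE a b w = 0) (hnorm : fockInner n w w = 1) :
    ∃ θ : ℝ, w = Complex.exp (θ * Complex.I) • psi hn J := by
  obtain ⟨z, hz⟩ := exists_eq_smul_of_highestWeight (p := ⟨0, by lia⟩) (q := ⟨1, by lia⟩) rfl rfl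
    hw hE
  obtain ⟨u, rfl⟩ : ∃ u : ℂ, w = u • psi hn J := by
    refine ⟨z * Real.sqrt (J.factorial * (J + 1).factorial), ?_⟩
    rw [hz, psi, smul_smul, mul_inv_cancel_right₀ (sqrt_factorial_mul_factorial_ne_zero J)]
  rw [map_smul, map_smulₛₗ, LinearMap.smul_apply, fockInner_psi, smul_eq_mul, smul_eq_mul,
    mul_one, Complex.mul_conj'] at hnorm
  have hu : ‖u‖ = 1 :=
    (pow_eq_one_iff_of_nonneg (norm_nonneg u) two_ne_zero).1 (by exact_mod_cast hnorm)
  obtain ⟨θ, hθ⟩ := (Complex.norm_eq_one_iff u).1 hu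
  exact ⟨θ, by rw [hθ]⟩

end Psi

/-! ### The Lie algebra `so*(2n)` acting by quadratic expressions -/

section ParticleHole

variable {L ι : Type*} [Ring L]

/-- The operators `(c, d')`: creation operators after the roles of creation and annihilation
have been exchanged in the second species of oscillators. -/
def particleHoleC (c d : ι ⊕ ι → L) : ι ⊕ ι → L :=
  Sum.elim (c ∘ .inl) (d ∘ .inr)

/-- The operators `(d, -c')`: annihilation operators after the roles of creation and annihilation
have been exchanged in the second species of oscillators. -/
def particleHoleD (c d : ι ⊕ ι → L) : ι ⊕ ι → L :=
  Sum.elim (d ∘ .inl) (-(c ∘ .inr))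

lemma CCR.particleHole [DecidableEq ι] {c d : ι ⊕ ι → L} (h : CCR c d) :
    CCR (particleHoleC c d) (particleHoleD c d) where
  lie_d_c := by
    rintro (i | i) (j | j)
    · simp [particleHoleC, particleHoleD, h.lie_d_c]
    · simp [particleHoleC, particleHoleD, h.lie_d_d]
    · simp [particleHoleC, particleHoleD, h.lie_c_c]
    · simp [particleHoleC, particleHoleD, h.lie_c_d, neg_ite, eq_comm]
  lie_c_c := by
    rintro (i | i) (j | j) <;> simp [particleHoleC, h.lie_c_c, h.lie_d_d, h.lie_d_c, h.lie_c_d]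
  lie_d_d := by
    rintro (i | i) (j | j) <;> simp [particleHoleD, h.lie_c_c, h.lie_d_d, h.lie_d_c, h.lie_c_d]

lemma sum_sum_smul_swap_of_transpose_eq_neg {R M : Type*} [Ring R] [AddCommGroup M] [Module R M]
    [Fintype ι] {Y : Matrix ι ι R} (hY : Yᵀ = -Y) (f : ι → ι → M) :
    ∑ a, ∑ b, Y a b • f b a = -∑ a, ∑ b, Y a b • f a b := by
  rw [Finset.sum_comm, ← Finset.sum_neg_distrib]
  refine Finset.sum_congr rfl fun a _ => ?_
  rw [← Finset.sum_neg_distrib]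
  exact Finset.sum_congr rfl fun b _ => by rw [← neg_smul]; exact congr($hY a b • f a b)

section QuadraticAction

variable {K A : Type*} [Field K] [NeZero (2 : K)] [Ring A] [Algebra K A] [Fintype ι]

lemma sum_half_smul_singletPair {x : ι ⊕ ι → A} (hx : ∀ i j, x i * x j = x j * x i)
    {Y : Matrix ι ι K} (hY : Yᵀ = -Y) :
    ∑ a, ∑ b, (1 / 2 * Y a b) • singletPair x a b =
      -∑ a, ∑ b, Y a b • (x (.inl a) * x (.inr b)) := by
  have hswap := sum_sum_smul_swap_of_transpose_eq_neg hY fun a b => x (.inl a) * x (.inr b)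
  simp only [mul_smul, ← Finset.smul_sum, singletPair, smul_sub, Finset.sum_sub_distrib,
    hx (.inr _), hswap]
  rw [smul_neg, ← neg_add', ← add_smul, add_halves, one_smul]

lemma CCR.quad_particleHole [DecidableEq ι] {c d : ι ⊕ ι → A} (h : CCR c d) (X : Matrix ι ι K)
    {Y Z : Matrix ι ι K} (hY : Yᵀ = -Y) (hZ : Zᵀ = -Z) :
    quad (particleHoleC c d) (particleHoleD c d) (fromBlocks X Y Z (-Xᵀ)) =
      ∑ a, ∑ b, (X a b • unitaryGen c d a b + (1 / 2 * Z a b) • singletPair d a b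
        + (1 / 2 * Y a b) • singletPair c a b) := by
  have hinr : ∑ a, ∑ b, X b a • (d (.inr a) * c (.inr b)) =
      ∑ a, ∑ b, X a b • (c (.inr a) * d (.inr b) + if a = b then 1 else 0) := by
    rw [Finset.sum_comm]
    simp only [h.d_mul_c, Sum.inr.injEq, eq_comm]
  have hZ' := sum_sum_smul_swap_of_transpose_eq_neg hZ fun a b => d (.inl a) * d (.inr b)
  simp only [Finset.sum_add_distrib, sum_half_smul_singletPair h.c_mul_c hY,
    sum_half_smul_singletPair h.d_mul_d hZ, ← hZ']
  simp only [quad, Fintype.sum_sum_type, particleHoleC, particleHoleD, Sum.elim_inl, Sum.elim_inr,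
    Function.comp_apply, Pi.neg_apply, fromBlocks_apply₁₁, fromBlocks_apply₁₂,
    fromBlocks_apply₂₁, fromBlocks_apply₂₂, Matrix.neg_apply, Matrix.transpose_apply, mul_neg,
    smul_neg, neg_smul, Finset.sum_add_distrib, Finset.sum_neg_distrib, hinr, unitaryGen,
    smul_add, h.d_mul_d (.inr _)]
  abel

end QuadraticAction

end ParticleHole

section LieAlgebra

variable {n : ℕ}

lemma opOf_fromBlocks_eq_quad (X : Matrix (Fin n) (Fin n) ℂ) {Y Z : Matrix (Fin n) (Fin n) ℂ}
    (hY : Yᵀ = -Y) (hZ : Zᵀ = -Z) :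
    opOf (fromBlocks X Y Z (-Xᵀ)) =
      quad (particleHoleC raise lower) (particleHoleD raise lower) (fromBlocks X Y Z (-Xᵀ)) :=
  (ccr.quad_particleHole X hY hZ).symm

lemma mem_lieAlg_iff {V : Mat2 n} :
    V ∈ lieAlg n ↔ ∃ X Y : Matrix (Fin n) (Fin n) ℂ,
      Xᴴ = -X ∧ Yᵀ = -Y ∧ V = fromBlocks X Y Yᴴ (-Xᵀ) := by
  change V.trace = 0 ∧ Vᴴ * hermForm n = -(hermForm n * V) ∧
    Vᵀ * symmForm n = -(symmForm n * V) ↔ _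
  refine ⟨?_, ?_⟩
  · rintro ⟨-, hherm, hsymm⟩
    rw [← fromBlocks_toBlocks V] at hherm hsymm ⊢
    simp only [hermForm, symmForm, fromBlocks_conjTranspose, fromBlocks_transpose,
      fromBlocks_multiply, fromBlocks_neg, Matrix.mul_one, Matrix.mul_zero, Matrix.one_mul,
      Matrix.zero_mul, Matrix.mul_neg, Matrix.neg_mul, add_zero, zero_add, fromBlocks_inj,
      neg_neg] at hherm hsymm
    refine ⟨V.toBlocks₁₁, V.toBlocks₁₂, hherm.1, hsymm.2.2.2, ?_⟩
    rw [hherm.2.2.1, hsymm.2.1, neg_neg]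
  · rintro ⟨X, Y, hX, hY, rfl⟩
    have hX' : (Xᵀ)ᴴ = -Xᵀ := by rw [← transpose_neg, ← hX]; rfl
    have hY' : (Yᴴ)ᵀ = -Yᴴ := by rw [← conjTranspose_neg, ← hY]; rfl
    refine ⟨by simp [Matrix.trace, Matrix.diag], ?_, ?_⟩
    · simp [hermForm, fromBlocks_conjTranspose, fromBlocks_multiply, fromBlocks_neg, hX, hX']
    · simp [symmForm, fromBlocks_transpose, fromBlocks_multiply, fromBlocks_neg, hY, hY']

lemma exists_eq_add_I_smul_of_transpose_eq_neg (X : Matrix (Fin n) (Fin n) ℂ)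
    {Y Z : Matrix (Fin n) (Fin n) ℂ} (hY : Yᵀ = -Y) (hZ : Zᵀ = -Z) :
    ∃ V₁ ∈ lieAlg n, ∃ V₂ ∈ lieAlg n,
      fromBlocks X Y Z (-Xᵀ) = V₁ + Complex.I • V₂ := by
  have hZ' : (Zᴴ)ᵀ = -Zᴴ := by rw [← conjTranspose_neg, ← hZ]; rfl
  have hI : Complex.I * (-Complex.I / 2) = 1 / 2 := by linear_combination -Complex.I_mul_I / 2
  have hX : (1 / 2 : ℂ) • (X - Xᴴ) + Complex.I • (-Complex.I / 2) • (X + Xᴴ) = X := by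
    rw [smul_smul, hI]
    module
  have hY₁₂ : (1 / 2 : ℂ) • (Y + Zᴴ) + Complex.I • (-Complex.I / 2) • (Y - Zᴴ) = Y := by
    rw [smul_smul, hI]
    module
  have hZ₁₂ : ((1 / 2 : ℂ) • (Y + Zᴴ))ᴴ + Complex.I • ((-Complex.I / 2) • (Y - Zᴴ))ᴴ = Z := by
    have hstar : star (-Complex.I / 2) = -(-Complex.I / 2) := by simp [neg_div]
    rw [conjTranspose_smul, conjTranspose_smul, hstar, smul_smul, mul_neg, hI,
      conjTranspose_add, conjTranspose_sub, conjTranspose_conjTranspose, star_div₀, star_one,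
      star_ofNat]
    module
  refine ⟨_, mem_lieAlg_iff.2 ⟨(1 / 2 : ℂ) • (X - Xᴴ), (1 / 2 : ℂ) • (Y + Zᴴ), ?_, ?_, rfl⟩,
    _, mem_lieAlg_iff.2 ⟨(-Complex.I / 2) • (X + Xᴴ), (-Complex.I / 2) • (Y - Zᴴ), ?_, ?_, rfl⟩,
    ?_⟩
  · simp [← smul_neg]
  · simp [hY, hZ', ← smul_neg, add_comm]
  · simp [neg_div, add_comm]
  · simp [hY, hZ', ← smul_neg, -smul_add, neg_add_eq_sub]
  · rw [fromBlocks_smul, fromBlocks_add, hX, hY₁₂, hZ₁₂, smul_neg, ← transpose_smul, ← neg_add,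
      ← transpose_add, hX]

end LieAlgebra

section Operators

variable {n : ℕ}

lemma opOf_apply (V : Mat2 n) (v : Fock n) :
    opOf V v = ∑ a : Fin n, ∑ b : Fin n, (V (.inl a) (.inl b) • opE a b v
      + ((1 / 2 : ℂ) * V (.inr a) (.inl b)) • opF a b v
      + ((1 / 2 : ℂ) * V (.inl a) (.inr b)) • opFt a b v) := by
  simp [opOf, LinearMap.sum_apply]

lemma opOf_add (V W : Mat2 n) : opOf (V + W) = opOf V + opOf W := by
  refine LinearMap.ext fun v => ?_
  simp only [opOf_apply, LinearMap.add_apply, Matrix.add_apply, mul_add, add_smul,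
    Finset.sum_add_distrib]
  abel

lemma opOf_smul (z : ℂ) (V : Mat2 n) : opOf (z • V) = z • opOf V := by
  refine LinearMap.ext fun v => ?_
  simp only [opOf_apply, LinearMap.smul_apply, Matrix.smul_apply, smul_eq_mul, Finset.smul_sum,
    smul_add, smul_smul, mul_left_comm]

lemma opOf_eq_quad {V : Mat2 n} (hV : V ∈ lieAlg n) :
    opOf V = quad (particleHoleC raise lower) (particleHoleD raise lower) V := by
  obtain ⟨X, Y, -, hY, rfl⟩ := mem_lieAlg_iff.1 hV
  exact opOf_fromBlocks_eq_quad X hY (by rw [← conjTranspose_neg, ← hY]; rfl)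

lemma opOf_lie {V W : Mat2 n} (hV : V ∈ lieAlg n) (hW : W ∈ lieAlg n) :
    opOf ⁅V, W⁆ = ⁅opOf V, opOf W⁆ := by
  rw [opOf_eq_quad ((lieAlg n).lie_mem hV hW), opOf_eq_quad hV, opOf_eq_quad hW]
  exact (ccr.particleHole.lie_quad_quad V W).symm

lemma fockInner_opOf_left {V : Mat2 n} (hV : V ∈ lieAlg n) (v w : Fock n) :
    fockInner n (opOf V v) w = -fockInner n v (opOf V w) := by
  obtain ⟨X, Y, hX, hY, rfl⟩ := mem_lieAlg_iff.1 hV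
  have hXE (a b : Fin n) : conj (X a b) = -X b a := congr($hX b a)
  have hYF (a b : Fin n) : Yᴴ a b = -conj (Y a b) := congr(conj ($hY a b)).trans (map_neg _ _)
  simp only [opOf_apply, map_sum, map_add, LinearMap.sum_apply, LinearMap.add_apply,
    map_smulₛₗ, LinearMap.smul_apply, fockInner_opE_left, fockInner_opF_left, fockInner_opFt_left,
    fromBlocks_apply₁₁, fromBlocks_apply₁₂, fromBlocks_apply₂₁, hXE, hYF, map_mul, map_div₀,
    map_one, map_ofNat, map_neg, Complex.conj_conj, Finset.sum_add_distrib]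
  rw [Finset.sum_comm]
  simp only [RingHom.id_apply, smul_eq_mul, neg_mul, mul_neg, Finset.sum_neg_distrib]
  abel

lemma opE_eq_opOf (a b : Fin n) :
    opE a b = opOf (fromBlocks (single a b 1) 0 0 (-(single a b 1)ᵀ)) := by
  refine LinearMap.ext fun v => ?_
  simp [opOf_apply, Matrix.single_apply, ite_and]

lemma opF_eq_opOf (a b : Fin n) :
    opF a b = opOf (fromBlocks 0 0 (single a b 1 - single b a 1) (-0ᵀ)) := by
  have hanti : opF b a = -opF a b := relations_opE_opF_opFt.F_antisymm a b
  refine LinearMap.ext fun v => ?_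
  simp [opOf_apply, Matrix.single_apply, ite_and, sub_smul, mul_sub, hanti, ← add_smul,
    ← two_mul]

lemma opFt_eq_opOf (a b : Fin n) :
    opFt a b = opOf (fromBlocks 0 (single a b 1 - single b a 1) 0 (-0ᵀ)) := by
  have hanti : opFt b a = -opFt a b := relations_opE_opF_opFt.Ft_antisymm a b
  refine LinearMap.ext fun v => ?_
  simp [opOf_apply, Matrix.single_apply, ite_and, sub_smul, mul_sub, hanti, ← add_smul,
    ← two_mul]

lemma opOf_fromBlocks_mem_of_stable {W : Submodule ℂ (Fock n)}
    (hW : ∀ V ∈ lieAlg n, ∀ v ∈ W, opOf V v ∈ W) (X : Matrix (Fin n) (Fin n) ℂ)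
    {Y Z : Matrix (Fin n) (Fin n) ℂ} (hY : Yᵀ = -Y) (hZ : Zᵀ = -Z) {v : Fock n} (hv : v ∈ W) :
    opOf (fromBlocks X Y Z (-Xᵀ)) v ∈ W := by
  obtain ⟨V₁, hV₁, V₂, hV₂, hV⟩ := exists_eq_add_I_smul_of_transpose_eq_neg X hY hZ
  rw [hV, opOf_add, opOf_smul]
  exact W.add_mem (hW V₁ hV₁ v hv) (W.smul_mem _ (hW V₂ hV₂ v hv))

lemma opE_opF_opFt_mem_of_opOf_stable {W : Submodule ℂ (Fock n)}
    (hW : ∀ V ∈ lieAlg n, ∀ v ∈ W, opOf V v ∈ W) (a b : Fin n) {v : Fock n} (hv : v ∈ W) :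
    opE a b v ∈ W ∧ opF a b v ∈ W ∧ opFt a b v ∈ W := by
  rw [opE_eq_opOf, opF_eq_opOf, opFt_eq_opOf]
  exact ⟨opOf_fromBlocks_mem_of_stable hW _ (by simp) (by simp) hv,
    opOf_fromBlocks_mem_of_stable hW _ (by simp) (by simp) hv,
    opOf_fromBlocks_mem_of_stable hW _ (by simp) (by simp) hv⟩

lemma opOf_mem_intertwinerSpace (V : Mat2 n) {v : Fock n} (hv : v ∈ intertwinerSpace n) :
    opOf V v ∈ intertwinerSpace n := by
  rw [intertwinerSpace_eq_invariants] at hv ⊢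
  rw [opOf_apply]
  refine Submodule.sum_mem _ fun a _ => Submodule.sum_mem _ fun b _ =>
    add_mem (add_mem ?_ ?_) ?_ <;> refine Submodule.smul_mem _ _ ?_
  exacts [(isScalarOp_opE a b).apply_mem_invariants hv,
    (isScalarOp_opF a b).apply_mem_invariants hv, (isScalarOp_opFt a b).apply_mem_invariants hv]

end Operators

section AdjointAction

/-- If `g` preserves the form `s`, then conjugation by `g` preserves the infinitesimal symmetries
of `s`; here `g'` and `V'` are the adjoints of `g` and `V`, and `h`, `h'` the inverses of `g`,
`g'`. -/
lemma conj_mul_eq_neg_of_mul_eq_neg {R : Type*} [Ring R] {s g g' h h' V V' : R}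
    (hgh : g * h = 1) (hgh' : h' * g' = 1) (hg : g' * s * g = s) (hV : V' * s = -(s * V)) :
    h' * V' * g' * s = -(s * (g * V * h)) := by
  have hleft : g' * s = s * h := by rw [← mul_one (g' * s), ← hgh, ← mul_assoc, hg]
  have hright : h' * s = s * g := by
    nth_rw 1 [← hg]
    rw [← mul_assoc, ← mul_assoc, hgh', one_mul]
  calc h' * V' * g' * s = h' * (V' * s) * h := by rw [mul_assoc _ g', hleft]; noncomm_ring
    _ = -(h' * s * V * h) := by rw [hV]; noncomm_ring
    _ = -(s * (g * V * h)) := by rw [hright]; noncomm_ring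

lemma conj_mem_lieAlg {n : ℕ} {g : (Mat2 n)ˣ} (hg : g ∈ group n) {V : Mat2 n}
    (hV : V ∈ lieAlg n) : (g : Mat2 n) * V * (g⁻¹ : (Mat2 n)ˣ) ∈ lieAlg n := by
  obtain ⟨-, hherm, hsymm⟩ := hg
  obtain ⟨htrace, hVherm, hVsymm⟩ := hV
  refine ⟨?_, ?_, ?_⟩
  · rw [trace_mul_comm, ← Matrix.mul_assoc, Units.inv_mul, Matrix.one_mul, htrace]
  · rw [conjTranspose_mul, conjTranspose_mul, ← Matrix.mul_assoc]
    exact conj_mul_eq_neg_of_mul_eq_neg g.mul_inv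
      (by rw [← conjTranspose_mul, g.mul_inv, conjTranspose_one]) hherm hVherm
  · rw [transpose_mul, transpose_mul, ← Matrix.mul_assoc]
    exact conj_mul_eq_neg_of_mul_eq_neg g.mul_inv
      (by rw [← transpose_mul, g.mul_inv, transpose_one]) hsymm hVsymm

end AdjointAction

/-! ### Second quantisation in the Bargmann picture -/

lemma CCR.sum_d_mul_sum_c {R A σ : Type*} [CommRing R] [Ring A] [Algebra R A] [Fintype σ]
    [DecidableEq σ] {c d : σ → A} (h : CCR c d) (x y : σ → R) :
    (∑ i, y i • d i) * ∑ j, x j • c j =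
      (∑ j, x j • c j) * ∑ i, y i • d i + (∑ i, y i * x i) • 1 := by
  simp only [Finset.sum_mul, Finset.mul_sum, smul_mul_smul_comm, h.d_mul_c, smul_add,
    Finset.sum_add_distrib, smul_ite, smul_zero, Finset.sum_ite_eq', Finset.mem_univ, if_true,
    Finset.sum_smul, mul_comm (x _)]
  congr 1
  exact Finset.sum_comm

section Bargmann

variable {n : ℕ}

/-- The norm `∏ i, √(μ i)!` of the monomial `∏ i, (a†_i)^(μ i)` applied to the vacuum. -/
def monomialNorm (μ : Occ n) : ℂ := ∏ i, (Real.sqrt ((μ i).factorial) : ℂ)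

lemma monomialNorm_ne_zero (μ : Occ n) : monomialNorm μ ≠ 0 :=
  Finset.prod_ne_zero_iff.2 fun i _ => by
    exact_mod_cast (Real.sqrt_pos.2 (Nat.cast_pos.2 (Nat.factorial_pos (μ i)))).ne'

lemma monomialNorm_add_single (μ : Occ n) (i : Fin n ⊕ Fin n) :
    monomialNorm (μ + Finsupp.single i 1) = Real.sqrt (μ i + 1) * monomialNorm μ := by
  rw [monomialNorm, monomialNorm, Fintype.prod_eq_mul_prod_compl i,
    Fintype.prod_eq_mul_prod_compl i, ← mul_assoc]
  congr 1
  · simp [Nat.factorial_succ]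
  · refine Finset.prod_congr rfl fun j hj => ?_
    have hne : j ≠ i := by simpa using hj
    simp [Finsupp.single_eq_of_ne hne]

/-- The Bargmann transform, which identifies the Fock space with the polynomials in such a way
that the creation operators become the multiplications by the variables. -/
def bargmann : Fock n ≃ₗ[ℂ] MvPolynomial (Fin n ⊕ Fin n) ℂ :=
  ((MvPolynomial.basisMonomials (Fin n ⊕ Fin n) ℂ).isUnitSMul fun μ : Occ n =>
    (inv_ne_zero (monomialNorm_ne_zero μ)).isUnit).repr.symm

lemma bargmann_ket (μ : Occ n) :
    bargmann (ket μ) = MvPolynomial.monomial μ (monomialNorm μ)⁻¹ := by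
  simp [bargmann, ket, Module.Basis.isUnitSMul_apply, MvPolynomial.smul_monomial]

lemma bargmann_vacuum : bargmann (vacuum n) = 1 := by
  simp [vacuum, bargmann_ket, monomialNorm]

lemma bargmann_raise (i : Fin n ⊕ Fin n) (v : Fock n) :
    bargmann (raise i v) = MvPolynomial.X i * bargmann v := by
  induction v using fock_induction_ket with
  | zero => simp
  | add v w hv hw => simp [hv, hw, mul_add]
  | ket μ z =>
    have hsqrt : (Real.sqrt (μ i + 1) : ℂ) ≠ 0 := by
      exact_mod_cast (Real.sqrt_pos.2 (by positivity)).ne'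
    simp only [map_smul, raise_ket, bargmann_ket, monomialNorm_add_single, MvPolynomial.X,
      MvPolynomial.monomial_mul, one_mul, add_comm (Finsupp.single i 1),
      MvPolynomial.smul_monomial, smul_eq_mul, mul_inv, mul_inv_cancel_left₀ hsqrt]

@[elab_as_elim]
lemma fock_induction_raise {p : Fock n → Prop} (v : Fock n) (vacuum : ∀ z : ℂ, p (z • vacuum n))
    (add : ∀ v w, p v → p w → p (v + w)) (raise : ∀ i v, p v → p (raise i v)) : p v := by
  rw [← bargmann.symm_apply_apply v]
  induction bargmann v using MvPolynomial.induction_on with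
  | C z =>
    rw [← mul_one (MvPolynomial.C z), ← MvPolynomial.smul_eq_C_mul, ← bargmann_vacuum, map_smul,
      LinearEquiv.symm_apply_apply]
    exact vacuum z
  | add q r hq hr => exact map_add bargmann.symm q r ▸ add _ _ hq hr
  | mul_X q i hq =>
    rw [mul_comm, ← bargmann.apply_symm_apply q, ← bargmann_raise, LinearEquiv.symm_apply_apply]
    exact raise i _ hq

/-- The operator on the Fock space that fixes the vacuum and transforms the creation operators
linearly by the matrix `V`: in the Bargmann picture, the substitution `X j ↦ ∑ i, V i j • X i`. -/
def secondQuant (V : Mat2 n) : Module.End ℂ (Fock n) :=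
  bargmann.symm.conj (MvPolynomial.bind₁ Vᵀ.toMvPolynomial).toLinearMap

lemma secondQuant_apply (V : Mat2 n) (v : Fock n) :
    secondQuant V v = bargmann.symm (MvPolynomial.bind₁ Vᵀ.toMvPolynomial (bargmann v)) := rfl

lemma secondQuant_one : secondQuant (1 : Mat2 n) = 1 :=
  LinearMap.ext fun v => by simp [secondQuant_apply]

lemma secondQuant_mul (V W : Mat2 n) : secondQuant (V * W) = secondQuant V * secondQuant W := by
  refine LinearMap.ext fun v => ?_
  have h : MvPolynomial.bind₁ (V * W)ᵀ.toMvPolynomial =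
      (MvPolynomial.bind₁ Vᵀ.toMvPolynomial).comp (MvPolynomial.bind₁ Wᵀ.toMvPolynomial) :=
    MvPolynomial.algHom_ext fun i => by simp [transpose_mul, toMvPolynomial_mul]
  rw [Module.End.mul_apply, secondQuant_apply, h]
  simp [secondQuant_apply]

lemma secondQuant_vacuum (V : Mat2 n) : secondQuant V (vacuum n) = vacuum n := by
  rw [secondQuant_apply, bargmann_vacuum, map_one, ← bargmann_vacuum,
    LinearEquiv.symm_apply_apply]

lemma secondQuant_raise (V : Mat2 n) (j : Fin n ⊕ Fin n) (v : Fock n) :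
    secondQuant V (raise j v) = ∑ i, V i j • raise i (secondQuant V v) := by
  apply bargmann.injective
  simp only [secondQuant_apply, bargmann_raise, map_mul, MvPolynomial.bind₁_X_right,
    LinearEquiv.apply_symm_apply, map_sum, map_smul, toMvPolynomial, transpose_apply,
    Finset.sum_mul]
  refine Finset.sum_congr rfl fun i _ => ?_
  rw [← smul_mul_assoc, MvPolynomial.X, MvPolynomial.smul_monomial, smul_eq_mul, mul_one]

lemma sum_lower_sum_raise (x y : Fin n ⊕ Fin n → ℂ) (v : Fock n) :
    ∑ i, y i • lower i (∑ j, x j • raise j v) =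
      ∑ j, x j • raise j (∑ i, y i • lower i v) + (∑ i, y i * x i) • v := by
  have h : (∑ i, y i • lower i) ((∑ j, x j • raise j) v) =
      (∑ j, x j • raise j) ((∑ i, y i • lower i) v) + (∑ i, y i * x i) • v :=
    congr($(ccr.sum_d_mul_sum_c x y) v)
  simpa only [LinearMap.sum_apply, LinearMap.smul_apply] using h

lemma secondQuant_lower {V V' : Mat2 n} (hV : V' * V = 1) (j : Fin n ⊕ Fin n) (v : Fock n) :
    secondQuant V (lower j v) = ∑ i, V' j i • lower i (secondQuant V v) := by
  induction v using fock_induction_raise with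
  | vacuum z => simp [secondQuant_vacuum, lower_vacuum]
  | add v w hv hw => simp only [map_add, hv, hw, smul_add, Finset.sum_add_distrib]
  | raise k v hv =>
    have hjk : lower j (raise k v) = raise k (lower j v) + (1 : Mat2 n) j k • v := by
      rw [Matrix.one_apply, ite_smul, one_smul, zero_smul]
      exact (congr($(ccr.d_mul_c j k) v)).trans (by split_ifs <;> rfl)
    rw [hjk, map_add, map_smul, secondQuant_raise, secondQuant_raise, hv, sum_lower_sum_raise,
      ← Matrix.mul_apply, hV]

lemma fockInner_vacuum_secondQuant (V : Mat2 n) (w : Fock n) :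
    fockInner n (vacuum n) (secondQuant V w) = fockInner n (vacuum n) w := by
  induction w using fock_induction_raise with
  | vacuum z => simp [secondQuant_vacuum]
  | add v w hv hw => simp only [map_add, hv, hw]
  | raise k v _ =>
    simp [secondQuant_raise, ← fockInner_lower_left, lower_vacuum]

lemma fockInner_secondQuant {V : Mat2 n} (hV : Vᴴ * V = 1) (v w : Fock n) :
    fockInner n (secondQuant V v) (secondQuant V w) = fockInner n v w := by
  induction v using fock_induction_raise generalizing w with
  | vacuum z => simp [secondQuant_vacuum, fockInner_vacuum_secondQuant]
  | add v v' hv hv' => simp only [map_add, LinearMap.add_apply, hv, hv']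
  | raise k v hv =>
    rw [fockInner_raise_left, ← hv, secondQuant_lower hV, secondQuant_raise]
    simp [fockInner_raise_left]

end Bargmann

/-! ### The action of the maximal compact subgroup -/

section Doubled

variable {ι R : Type*}

/-- The matrix by which `U(n)` transforms the creation operators: `U` acts on each of the two
species of oscillators. -/
def doubled [Zero R] (U : Matrix ι ι R) : Matrix (ι ⊕ ι) (ι ⊕ ι) R := fromBlocks U 0 0 U

lemma doubled_one [DecidableEq ι] [Zero R] [One R] : doubled (1 : Matrix ι ι R) = 1 :=
  fromBlocks_one

lemma doubled_mul [Fintype ι] [NonUnitalNonAssocSemiring R] (U W : Matrix ι ι R) :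
    doubled (U * W) = doubled U * doubled W := by
  simp [doubled, fromBlocks_multiply]

lemma doubled_conjTranspose [AddMonoid R] [StarAddMonoid R] (U : Matrix ι ι R) :
    (doubled U)ᴴ = doubled Uᴴ := by
  simp [doubled, fromBlocks_conjTranspose]

lemma doubled_mul_sl2Matrix [Fintype ι] [DecidableEq ι] [CommRing R] (U : Matrix ι ι R)
    (p q r : R) : doubled U * sl2Matrix ι p q r = sl2Matrix ι p q r * doubled U := by
  simp [doubled, sl2Matrix, fromBlocks_multiply]

lemma sum_smul_unitaryGen {A : Type*} [Fintype ι] [DecidableEq ι] [CommRing R] [Ring A]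
    [Algebra R A] (c d : ι ⊕ ι → A) (X : Matrix ι ι R) :
    ∑ a, ∑ b, X a b • unitaryGen c d a b = X.trace • 1 + quad c d (doubled X) := by
  simp [unitaryGen, quad, doubled, trace, Fintype.sum_sum_type, Finset.sum_add_distrib,
    Finset.sum_smul, add_comm]

end Doubled

section SecondQuant

variable {n : ℕ}

lemma secondQuant_mul_quad {V V' : Mat2 n} (hV : V' * V = 1) (X : Mat2 n) :
    secondQuant V * quad raise lower X = quad raise lower (V * X * V') * secondQuant V :=
  mul_quad_of_intertwining
    (fun j => LinearMap.ext fun v => by simp [secondQuant_raise])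
    (fun j => LinearMap.ext fun v => by simp [secondQuant_lower hV]) X

lemma commute_quad_secondQuant {V V' X : Mat2 n} (hV : V' * V = 1) (hX : V * X = X * V) :
    Commute (quad raise lower X) (secondQuant V) := by
  have h := secondQuant_mul_quad hV X
  rw [hX, Matrix.mul_assoc, mul_eq_one_comm.1 hV, Matrix.mul_one] at h
  exact h.symm

lemma exists_finiteDimensional_forall_secondQuant_mem (v : Fock n) :
    ∃ U : Submodule ℂ (Fock n), FiniteDimensional ℂ U ∧ ∀ V, secondQuant V v ∈ U := by
  induction v using fock_induction_raise with
  | vacuum z =>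
    refine ⟨ℂ ∙ vacuum n, inferInstance, fun V => ?_⟩
    rw [map_smul, secondQuant_vacuum]
    exact Submodule.smul_mem _ z (Submodule.mem_span_singleton_self _)
  | add v w hv hw =>
    obtain ⟨U₁, _, hU₁⟩ := hv
    obtain ⟨U₂, _, hU₂⟩ := hw
    exact ⟨U₁ ⊔ U₂, inferInstance, fun V =>
      map_add (secondQuant V) v w ▸ Submodule.add_mem_sup (hU₁ V) (hU₂ V)⟩
  | raise j v hv =>
    obtain ⟨U, _, hU⟩ := hv
    refine ⟨⨆ i, U.map (raise i), inferInstance, fun V => ?_⟩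
    rw [secondQuant_raise]
    exact Submodule.sum_mem _ fun i _ => Submodule.smul_mem _ _ <|
      Submodule.mem_iSup_of_mem i <| Submodule.mem_map_of_mem (hU V)

lemma continuous_apply_secondQuant (v : Fock n) (f : Fock n →ₗ[ℂ] ℂ) :
    Continuous fun V : Mat2 n => f (secondQuant V v) := by
  induction v using fock_induction_raise generalizing f with
  | vacuum z => simpa only [map_smul, secondQuant_vacuum] using continuous_const
  | add v w hv hw => simpa only [map_add] using (hv f).fun_add (hw f)
  | raise j v hv =>
    simp only [secondQuant_raise, map_sum, map_smul, smul_eq_mul]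
    exact continuous_finsetSum _ fun i _ =>
      (continuous_id.matrix_elem i j).mul (hv (f ∘ₗ raise i))

end SecondQuant

section UnitaryPart

variable {n : ℕ}

/-- The isomorphism `diag(U, conj U) ↦ U` of `K` with `U(n)`, as a map to matrices. -/
def unitaryPart (n : ℕ) : maxCompact n →* Matrix (Fin n) (Fin n) ℂ where
  toFun k := (kMat k).toBlocks₁₁
  map_one' := by
    change (1 : Mat2 n).toBlocks₁₁ = 1
    rw [← fromBlocks_one, toBlocks_fromBlocks₁₁]
  map_mul' k l := by
    obtain ⟨U, -, hk⟩ := k.2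
    obtain ⟨W, -, hl⟩ := l.2
    change (kMat k * kMat l).toBlocks₁₁ = (kMat k).toBlocks₁₁ * (kMat l).toBlocks₁₁
    simp only [kMat, hk, hl, fromBlocks_multiply, toBlocks_fromBlocks₁₁, Matrix.zero_mul, add_zero]

lemma kMat_eq_fromBlocks (k : maxCompact n) :
    kMat k = fromBlocks (unitaryPart n k) 0 0 ((unitaryPart n k).map conj) := by
  obtain ⟨U, -, hk⟩ := k.2
  change kMat k = fromBlocks (kMat k).toBlocks₁₁ 0 0 ((kMat k).toBlocks₁₁.map conj)
  rw [kMat, hk, toBlocks_fromBlocks₁₁]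

lemma unitaryPart_mem (k : maxCompact n) : unitaryPart n k ∈ unitaryGroup (Fin n) ℂ := by
  obtain ⟨U, hU, hk⟩ := k.2
  change (kMat k).toBlocks₁₁ ∈ _
  rwa [kMat, hk, toBlocks_fromBlocks₁₁]

lemma unitaryPart_inv (k : maxCompact n) : unitaryPart n k⁻¹ = (unitaryPart n k)ᴴ := by
  have h : unitaryPart n k * unitaryPart n k⁻¹ = 1 := by rw [← map_mul, mul_inv_cancel, map_one]
  exact (left_inv_eq_right_inv (mem_unitaryGroup_iff'.1 (unitaryPart_mem k)) h).symm

lemma conjTranspose_doubled_unitaryPart_mul (k : maxCompact n) :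
    (doubled (unitaryPart n k))ᴴ * doubled (unitaryPart n k) = 1 := by
  rw [doubled_conjTranspose, ← doubled_mul, ← unitaryPart_inv, ← map_mul, inv_mul_cancel, map_one,
    doubled_one]

lemma continuous_unitaryPart : Continuous (unitaryPart n) :=
  have h : Continuous (kMat : maxCompact n → Mat2 n) :=
    Units.continuous_val.comp (continuous_subtype_val.comp continuous_subtype_val)
  h.matrix_submatrix .inl .inl

end UnitaryPart

section CompactRep

variable {n : ℕ}

/-- The representation of `K ≅ U(n)` on the Fock space. The factor `det U` integrates the
summand `δ_ab` of `E_ab`. -/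
def compactRep (n : ℕ) : maxCompact n →* Module.End ℂ (Fock n) where
  toFun k := (unitaryPart n k).det • secondQuant (doubled (unitaryPart n k))
  map_one' := by rw [map_one, det_one, doubled_one, secondQuant_one, one_smul]
  map_mul' k l := by
    rw [map_mul, det_mul, doubled_mul, secondQuant_mul, smul_mul_smul_comm]

lemma compactRep_apply (k : maxCompact n) :
    compactRep n k = (unitaryPart n k).det • secondQuant (doubled (unitaryPart n k)) := rfl

lemma commute_quad_compactRep (k : maxCompact n) {X : Mat2 n}
    (hX : doubled (unitaryPart n k) * X = X * doubled (unitaryPart n k)) :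
    Commute (quad raise lower X) (compactRep n k) :=
  (commute_quad_secondQuant (conjTranspose_doubled_unitaryPart_mul k) hX).smul_right _

lemma isScalarOp_compactRep (k : maxCompact n) : IsScalarOp (compactRep n k) :=
  isScalarOp_of_commute_quad fun p q r =>
    commute_quad_compactRep k (doubled_mul_sl2Matrix _ p q r)

lemma compactRep_mem_intertwinerSpace (k : maxCompact n) {v : Fock n}
    (hv : v ∈ intertwinerSpace n) : compactRep n k v ∈ intertwinerSpace n := by
  rw [intertwinerSpace_eq_invariants] at hv ⊢
  exact (isScalarOp_compactRep k).apply_mem_invariants hv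

lemma compactRep_mem_areaSpace (k : maxCompact n) {J : ℕ} {v : Fock n}
    (hv : v ∈ areaSpace n J) : compactRep n k v ∈ areaSpace n J := by
  refine (isScalarOp_compactRep k).apply_mem_areaSpace ?_ hv
  rw [sub_self, zero_smul]
  exact sub_eq_zero.2 (commute_quad_compactRep k (by rw [mul_one, one_mul])).eq

lemma fockInner_compactRep (k : maxCompact n) (v w : Fock n) :
    fockInner n (compactRep n k v) (compactRep n k w) = fockInner n v w := by
  have hdet : (unitaryPart n k).det * conj (unitaryPart n k).det = 1 :=
    Unitary.mul_star_self_of_mem (det_of_mem_unitary (unitaryPart_mem k))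
  simp only [compactRep_apply, LinearMap.smul_apply, map_smul, map_smulₛₗ, smul_eq_mul,
    fockInner_secondQuant (conjTranspose_doubled_unitaryPart_mul k)]
  rw [← mul_assoc, hdet, one_mul]

lemma secondQuant_particleHoleC (k : maxCompact n) (j : Fin n ⊕ Fin n) :
    secondQuant (doubled (unitaryPart n k)) * particleHoleC raise lower j =
      (∑ i, kMat k i j • particleHoleC raise lower i) *
        secondQuant (doubled (unitaryPart n k)) := by
  refine LinearMap.ext fun v => ?_
  rw [kMat_eq_fromBlocks]
  rcases j with j | j
  · simp [particleHoleC, secondQuant_raise, doubled]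
  · simp only [particleHoleC, Sum.elim_inr, Function.comp_apply, Module.End.mul_apply,
      secondQuant_lower (conjTranspose_doubled_unitaryPart_mul k)]
    simp [doubled]

lemma secondQuant_particleHoleD (k : maxCompact n) (j : Fin n ⊕ Fin n) :
    secondQuant (doubled (unitaryPart n k)) * particleHoleD raise lower j =
      (∑ i, kMat k⁻¹ j i • particleHoleD raise lower i) *
        secondQuant (doubled (unitaryPart n k)) := by
  refine LinearMap.ext fun v => ?_
  rw [kMat_eq_fromBlocks, unitaryPart_inv]
  rcases j with j | j
  · simp only [particleHoleD, Sum.elim_inl, Function.comp_apply, Module.End.mul_apply,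
      secondQuant_lower (conjTranspose_doubled_unitaryPart_mul k)]
    simp [doubled]
  · simp [particleHoleD, secondQuant_raise, doubled]

lemma compactRep_mul_opOf (k : maxCompact n) {X : Mat2 n} (hX : X ∈ lieAlg n) :
    compactRep n k * opOf X = opOf (kMat k * X * kMat k⁻¹) * compactRep n k := by
  have hkX : kMat k * X * kMat k⁻¹ ∈ lieAlg n := conj_mem_lieAlg (k : group n).2 hX
  rw [opOf_eq_quad hX, opOf_eq_quad hkX, compactRep_apply, smul_mul_assoc, mul_smul_comm]
  exact congr(_ • $(mul_quad_of_intertwining (secondQuant_particleHoleC k)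
    (secondQuant_particleHoleD k) X))

lemma exists_finiteDimensional_forall_compactRep_mem (v : Fock n) :
    ∃ U : Submodule ℂ (Fock n), FiniteDimensional ℂ U ∧ ∀ k, compactRep n k v ∈ U := by
  obtain ⟨U, hfin, hU⟩ := exists_finiteDimensional_forall_secondQuant_mem v
  exact ⟨U, hfin, fun k => U.smul_mem _ (hU _)⟩

lemma continuous_apply_compactRep (v : Fock n) (f : Fock n →ₗ[ℂ] ℂ) :
    Continuous fun k => f (compactRep n k v) := by
  have hdoubled : Continuous fun k => doubled (unitaryPart n k) :=
    continuous_unitaryPart.matrix_fromBlocks continuous_const continuous_const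
      continuous_unitaryPart
  simp only [compactRep_apply, LinearMap.smul_apply, map_smul]
  exact continuous_unitaryPart.matrix_det.smul ((continuous_apply_secondQuant v f).comp hdoubled)

end CompactRep

/-! ### The derivative of the action of the maximal compact subgroup -/

section Jacobi

lemma hasDerivAt_det {𝕜 R ι : Type*} [NontriviallyNormedField 𝕜] [NormedCommRing R]
    [NormedAlgebra 𝕜 R] [Fintype ι] [DecidableEq ι] {M : 𝕜 → Matrix ι ι R} {M' : Matrix ι ι R}
    {t : 𝕜} (hM : ∀ i j, HasDerivAt (fun s => M s i j) (M' i j) t) :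
    HasDerivAt (fun s => (M s).det) (trace (M' * adjugate (M t))) t := by
  let detMultilinear : ContinuousMultilinearMap 𝕜 (fun _ : ι => ι → R) R :=
    { detRowAlternating.toMultilinearMap.restrictScalars 𝕜 with
      cont := Continuous.matrix_det continuous_id }
  have h := (detMultilinear.hasFDerivAt (M t)).comp_hasDerivAt t
    (hasDerivAt_pi.2 fun i => hasDerivAt_pi.2 (hM i))
  refine h.congr_deriv ((detMultilinear.linearDeriv_apply (M t) M').trans ?_)
  refine Finset.sum_congr rfl fun i _ => ?_
  change ((M t).updateRow i (M' i)).det = _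
  rw [← cramer_transpose_apply, cramer_eq_adjugate_mulVec, ← adjugate_transpose, mulVec_transpose]
  rfl

lemma hasDerivAt_exp_smul_apply {ι : Type*} [Fintype ι] [DecidableEq ι] (Y : Matrix ι ι ℂ)
    (i j : ι) : HasDerivAt (fun t : ℝ => NormedSpace.exp (t • Y) i j) (Y i j) 0 := by
  let _ : NormedRing (Matrix ι ι ℂ) := Matrix.linftyOpNormedRing
  let _ : NormedAlgebra ℝ (Matrix ι ι ℂ) := Matrix.linftyOpNormedAlgebra
  have h := hasDerivAt_exp_smul_const (𝕂 := ℝ) Y 0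
  rw [zero_smul, NormedSpace.exp_zero, one_mul] at h
  exact hasDerivAt_pi.1 (hasDerivAt_pi.1 h i) j

end Jacobi

section Derivative

variable {n : ℕ}

lemma hasDerivAt_apply_secondQuant {V : ℝ → Mat2 n} {X : Mat2 n} (hV₀ : V 0 = 1)
    (hV : ∀ i j, HasDerivAt (fun t => V t i j) (X i j) 0) (v : Fock n) (f : Fock n →ₗ[ℂ] ℂ) :
    HasDerivAt (fun t => f (secondQuant (V t) v)) (f (quad raise lower X v)) 0 := by
  induction v using fock_induction_raise generalizing f with
  | vacuum z =>
    have hquad : quad raise lower X (z • vacuum n) = 0 := by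
      simp [quad, LinearMap.sum_apply, lower_vacuum]
    simpa only [map_smul, secondQuant_vacuum, hquad, map_zero] using hasDerivAt_const _ _
  | add v w hv hw => simpa only [map_add] using (hv f).fun_add (hw f)
  | raise j v hv =>
    have hquad : quad raise lower X (raise j v) =
        ∑ i, X i j • raise i v + raise j (quad raise lower X v) := by
      have h := congr($(ccr.lie_quad_c X j) v)
      simpa [LinearMap.sum_apply] using sub_eq_iff_eq_add.1 h
    have h := HasDerivAt.fun_sum (u := Finset.univ) fun i _ =>
      (hV i j).fun_mul (hv (f ∘ₗ raise i))
    simp only [secondQuant_raise, map_sum, map_smul, smul_eq_mul]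
    refine h.congr_deriv ?_
    rw [hV₀, secondQuant_one, hquad, map_add, map_sum, Finset.sum_add_distrib]
    simp [Matrix.one_apply]

lemma hasDerivAt_apply_det_smul_secondQuant {U : ℝ → Matrix (Fin n) (Fin n) ℂ}
    {X : Matrix (Fin n) (Fin n) ℂ} (hU₀ : U 0 = 1)
    (hU : ∀ i j, HasDerivAt (fun t => U t i j) (X i j) 0) (v : Fock n) (f : Fock n →ₗ[ℂ] ℂ) :
    HasDerivAt (fun t => f ((U t).det • secondQuant (doubled (U t)) v))
      (f (∑ a, ∑ b, X a b • opE a b v)) 0 := by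
  have hdet : HasDerivAt (fun t => (U t).det) X.trace 0 := by
    simpa [hU₀] using hasDerivAt_det hU
  have hquant : HasDerivAt (fun t => f (secondQuant (doubled (U t)) v))
      (f (quad raise lower (doubled X) v)) 0 := by
    refine hasDerivAt_apply_secondQuant (by rw [hU₀, doubled_one]) ?_ v f
    rintro (i | i) (j | j)
    exacts [hU i j, hasDerivAt_const _ _, hasDerivAt_const _ _, hU i j]
  have hsum : ∑ a, ∑ b, X a b • opE a b v =
      X.trace • v + quad raise lower (doubled X) v := by
    have h : (∑ a, ∑ b, X a b • opE a b) v = _ := congr($(sum_smul_unitaryGen raise lower X) v)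
    simpa [LinearMap.sum_apply] using h
  simp only [map_smul, smul_eq_mul]
  refine (hdet.fun_mul hquant).congr_deriv ?_
  rw [hsum, hU₀, doubled_one, secondQuant_one, det_one, one_mul, map_add, map_smul,
    Module.End.one_apply, smul_eq_mul]

lemma hasDerivAt_apply_compactRep {Y : Mat2 n} {γ : ℝ → maxCompact n}
    (hγ : ∀ t : ℝ, kMat (γ t) = NormedSpace.exp (t • Y)) (v : Fock n) (f : Fock n →ₗ[ℂ] ℂ) :
    HasDerivAt (fun t => f (compactRep n (γ t) v)) (f (opOf Y v)) 0 := by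
  have hderiv (i j : Fin n ⊕ Fin n) : HasDerivAt (fun t => kMat (γ t) i j) (Y i j) 0 := by
    simpa only [hγ] using hasDerivAt_exp_smul_apply Y i j
  have hY₁₂ (a b : Fin n) : Y (.inl a) (.inr b) = 0 := by
    refine (hderiv _ _).unique ?_
    simp only [kMat_eq_fromBlocks]
    exact hasDerivAt_const _ _
  have hY₂₁ (a b : Fin n) : Y (.inr a) (.inl b) = 0 := by
    refine (hderiv _ _).unique ?_
    simp only [kMat_eq_fromBlocks]
    exact hasDerivAt_const _ _
  have hU₀ : unitaryPart n (γ 0) = 1 := by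
    change (kMat (γ 0)).toBlocks₁₁ = 1
    rw [hγ, zero_smul, NormedSpace.exp_zero, ← fromBlocks_one, toBlocks_fromBlocks₁₁]
  have hopOf : opOf Y v = ∑ a, ∑ b, Y.toBlocks₁₁ a b • opE a b v := by
    simp [opOf_apply, hY₁₂, hY₂₁, toBlocks₁₁]
  rw [hopOf]
  exact hasDerivAt_apply_det_smul_secondQuant hU₀ (fun i j => hderiv (.inl i) (.inl j)) v f

end Derivative

/-! ### The `(𝔤, K)`-module of intertwiners -/

namespace GKModule

variable {n : ℕ}

/-- The restriction of a `(𝔤, K)`-module to a subspace preserved by `𝔤` and `K`. -/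
def restrict {M : Type} [AddCommGroup M] [Module ℂ M] (π : GKModule n M) (H : Submodule ℂ M)
    (hlie : ∀ X, ∀ v ∈ H, π.lieAction X v ∈ H) (hcompact : ∀ k, ∀ v ∈ H, π.compactAction k v ∈ H) :
    GKModule n H where
  lieAction :=
    { toFun X := (π.lieAction X).restrict (hlie X)
      map_add' X Y := by ext; simp
      map_smul' c X := by ext; simp
      map_lie' {X Y} := by ext; simp }
  compactAction :=
    { toFun k := (π.compactAction k).restrict (hcompact k)
      map_one' := by ext; simp
      map_mul' k l := by ext; simp }
  ad_compat k X := by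
    obtain ⟨Y, hY, h⟩ := π.ad_compat k X
    exact ⟨Y, hY, LinearMap.ext fun v => Subtype.ext congr($h v)⟩
  finite v := by
    have hfg := Submodule.fg_iff_finiteDimensional _ |>.2 (π.finite v)
    refine Submodule.fg_iff_finiteDimensional _ |>.1
      (Submodule.fg_of_fg_map_injective H.subtype H.injective_subtype ?_)
    rwa [Submodule.map_span, ← Set.range_comp]
  continuous v f := by
    obtain ⟨g, rfl⟩ := LinearMap.exists_extend f
    exact π.continuous v g
  deriv Y γ hγ v f := by
    obtain ⟨g, rfl⟩ := LinearMap.exists_extend f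
    exact π.deriv Y γ hγ v g

end GKModule

section IntertwinerModule

variable {n : ℕ}

/-- The representation of `so*(2n)` on the Fock space. -/
def lieRep (n : ℕ) : lieAlg n →ₗ⁅ℝ⁆ Module.End ℂ (Fock n) where
  toFun X := opOf (X : Mat2 n)
  map_add' X Y := LinearMap.ext fun v => congr($(opOf_add (X : Mat2 n) Y) v)
  map_smul' c X := LinearMap.ext fun v => by
    have h : ((c • X : lieAlg n) : Mat2 n) = (c : ℂ) • (X : Mat2 n) := by ext; simp
    rw [h, opOf_smul]
    rfl
  map_lie' {X Y} := LinearMap.ext fun v => congr($(opOf_lie X.2 Y.2) v)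

/-- The `(𝔤, K)`-module structure of the Fock space. -/
def fockModule (n : ℕ) : GKModule n (Fock n) where
  lieAction := lieRep n
  compactAction := compactRep n
  ad_compat k X := ⟨⟨_, conj_mem_lieAlg (k : group n).2 X.2⟩, rfl, compactRep_mul_opOf k X.2⟩
  finite v := by
    obtain ⟨U, _, hU⟩ := exists_finiteDimensional_forall_compactRep_mem v
    exact Submodule.finiteDimensional_of_le (Submodule.span_le.2 (Set.range_subset_iff.2 hU))
  continuous := continuous_apply_compactRep
  deriv _ _ hγ := hasDerivAt_apply_compactRep hγ

lemma fockModule_lieAction (X : lieAlg n) :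
    (fockModule n).lieAction X = opOf (X : Mat2 n) := rfl

/-- The `(𝔤, K)`-module structure of the space of intertwiners. -/
def intertwinerModule (n : ℕ) : GKModule n (intertwinerSpace n) :=
  (fockModule n).restrict (intertwinerSpace n)
    (fun X _ hv => fockModule_lieAction X ▸ opOf_mem_intertwinerSpace (X : Mat2 n) hv)
    (fun k _ hv => compactRep_mem_intertwinerSpace k hv)

lemma intertwinerModule_isUnitary : (intertwinerModule n).IsUnitary
    ((fockInner n).domRestrict₁₂ (intertwinerSpace n) (intertwinerSpace n)) where
  hermitian v w := conj_fockInner v.1 w.1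
  pos v hv := fockInner_self_re_pos (by simpa using hv)
  skew X v w := fockInner_opOf_left X.2 v.1 w.1
  unitary k v w := fockInner_compactRep k v.1 w.1

lemma vacuum_mem_intertwinerSpace : vacuum n ∈ intertwinerSpace n :=
  Submodule.mem_iSup_of_mem 0 vacuum_mem_areaSpace

lemma intertwinerModule_isIrreducible : (intertwinerModule n).IsIrreducible := by
  refine ⟨⟨⟨vacuum n, vacuum_mem_intertwinerSpace⟩, 0, fun h => vacuum_ne_zero congr(($h).1)⟩,
    fun W hW _ => ?_⟩
  have hstable : ∀ V ∈ lieAlg n, ∀ v ∈ W.map (intertwinerSpace n).subtype,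
      opOf V v ∈ W.map (intertwinerSpace n).subtype := by
    rintro V hV _ ⟨v, hv, rfl⟩
    exact ⟨_, hW ⟨V, hV⟩ v hv, rfl⟩
  have hle : W.map (intertwinerSpace n).subtype ≤ intertwinerSpace n :=
    Submodule.map_subtype_le _ _
  have hirr := intertwinerSpace_irreducible hle
    (fun a b v hv => (opE_opF_opFt_mem_of_opOf_stable hstable a b hv).2.1)
    (fun a b v hv => (opE_opF_opFt_mem_of_opOf_stable hstable a b hv).2.2)
  have hinj := Submodule.map_injective_of_injective (intertwinerSpace n).injective_subtype
  exact hirr.imp (fun h => hinj (h.trans (Submodule.map_bot _).symm))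
    fun h => hinj (h.trans (Submodule.map_subtype_top _).symm)

end IntertwinerModule

end SOStar

end

theorem mainTheorem9 (n : ℕ) :
    -- the operators are scalar operators for SU(2)
    (∀ a b : Fin n, SOStar.IsScalarOp (SOStar.opE a b) ∧ SOStar.IsScalarOp (SOStar.opF a b) ∧
      SOStar.IsScalarOp (SOStar.opFt a b)) ∧
    -- they satisfy the commutation relations of the complexification of so*(2n)
    SOStar.Relations (n := n) (L := Module.End ℂ (SOStar.Fock n))
      SOStar.opE SOStar.opF SOStar.opFt ∧
    -- adjointness relations
    (∀ (a b : Fin n) (v w : SOStar.Fock n),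
      SOStar.fockInner n (SOStar.opE a b v) w = SOStar.fockInner n v (SOStar.opE b a w) ∧
      SOStar.fockInner n (SOStar.opF a b v) w = SOStar.fockInner n v (SOStar.opFt a b w)) ∧
    -- the intertwiner space consists of all the invariant vectors
    SOStar.intertwinerSpace n = SOStar.invariants n ∧
    -- the intertwiner space is stable under the operators, and irreducible under them
    (∀ (a b : Fin n), ∀ v ∈ SOStar.intertwinerSpace n,
      SOStar.opE a b v ∈ SOStar.intertwinerSpace n ∧
      SOStar.opF a b v ∈ SOStar.intertwinerSpace n ∧
      SOStar.opFt a b v ∈ SOStar.intertwinerSpace n) ∧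
    (∀ W : Submodule ℂ (SOStar.Fock n), W ≤ SOStar.intertwinerSpace n →
      (∀ (a b : Fin n), ∀ v ∈ W,
        SOStar.opE a b v ∈ W ∧ SOStar.opF a b v ∈ W ∧ SOStar.opFt a b v ∈ W) →
      W = ⊥ ∨ W = SOStar.intertwinerSpace n) ∧
    -- it is an irreducible unitary (𝔤, K)-module for SO*(2n), with 𝔤 acting by these operators
    (∃ π : SOStar.GKModule n (SOStar.intertwinerSpace n),
      (∀ (X : SOStar.lieAlg n) (v : SOStar.intertwinerSpace n),
        ((π.lieAction X v : SOStar.intertwinerSpace n) : SOStar.Fock n) =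
          SOStar.opOf (X : SOStar.Mat2 n) v) ∧
      π.IsUnitary ((SOStar.fockInner n).domRestrict₁₂
        (SOStar.intertwinerSpace n) (SOStar.intertwinerSpace n)) ∧
      π.IsIrreducible ∧
      -- U(n) preserves the spaces of fixed total area
      (∀ (J : ℕ) (k : SOStar.maxCompact n) (v : SOStar.intertwinerSpace n),
        (v : SOStar.Fock n) ∈ SOStar.areaSpace n J →
        ((π.compactAction k v : SOStar.intertwinerSpace n) : SOStar.Fock n) ∈
          SOStar.areaSpace n J)) ∧
    -- the irreducible U(n)-module of total area J, and its normalised highest weight vector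
    (∀ (hn : 2 ≤ n) (J : ℕ),
      (∀ (a b : Fin n), ∀ v ∈ SOStar.areaSpace n J, SOStar.opE a b v ∈ SOStar.areaSpace n J) ∧
      (∀ W : Submodule ℂ (SOStar.Fock n), W ≤ SOStar.areaSpace n J →
        (∀ (a b : Fin n), ∀ v ∈ W, SOStar.opE a b v ∈ W) →
        W = ⊥ ∨ W = SOStar.areaSpace n J) ∧
      SOStar.psi hn J ∈ SOStar.areaSpace n J ∧
      SOStar.fockInner n (SOStar.psi hn J) (SOStar.psi hn J) = 1 ∧
      SOStar.IsHighestWeight (fun a : Fin n => if (a : ℕ) < 2 then (J : ℂ) + 1 else 1)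
        (SOStar.psi hn J) ∧
      (∀ (l : Fin n → ℂ) (w : SOStar.Fock n), w ∈ SOStar.areaSpace n J →
        SOStar.IsHighestWeight l w → SOStar.fockInner n w w = 1 →
        ∃ θ : ℝ, w = Complex.exp (θ * Complex.I) • SOStar.psi hn J)) := by
  refine ⟨fun a b => ⟨SOStar.isScalarOp_opE a b, SOStar.isScalarOp_opF a b,
      SOStar.isScalarOp_opFt a b⟩, SOStar.relations_opE_opF_opFt,
    fun a b v w => ⟨SOStar.fockInner_opE_left a b v w, SOStar.fockInner_opF_left a b v w⟩,
    SOStar.intertwinerSpace_eq_invariants, fun a b v hv => ?_,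
    fun W hW h => SOStar.intertwinerSpace_irreducible hW (fun a b v hv => (h a b v hv).2.1)
      (fun a b v hv => (h a b v hv).2.2),
    ⟨SOStar.intertwinerModule n, fun _ _ => rfl, SOStar.intertwinerModule_isUnitary,
      SOStar.intertwinerModule_isIrreducible,
      fun J k v hv => SOStar.compactRep_mem_areaSpace k hv⟩,
    fun hn J => ⟨fun a b v hv => SOStar.opE_mem_areaSpace a b hv,
      fun W hW hE => SOStar.areaSpace_irreducible hn hW hE, SOStar.psi_mem_areaSpace hn,
      SOStar.fockInner_psi hn, SOStar.isHighestWeight_psi hn,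
      fun l w hw hl h1 => SOStar.exists_eq_exp_smul_psi hn hw hl.2.2 h1⟩⟩
  rw [SOStar.intertwinerSpace_eq_invariants] at hv ⊢
  exact ⟨(SOStar.isScalarOp_opE a b).apply_mem_invariants hv,
    (SOStar.isScalarOp_opF a b).apply_mem_invariants hv,
    (SOStar.isScalarOp_opFt a b).apply_mem_invariants hv⟩
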